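/- **Setting.** A *surface* is a (pseudo)metric space $M$. A *system* is a finite collection of sites, each placed at a point of $M$ and carrying a finite-dimensional Hilbert space. A *local quantum circuit* of depth $D$ with gates of diameter at most $r$ is a product of $D$ layers, each consisting of unitary gates acting on pairwise disjoint sets of sites of diameter at most $r$. *LED with correction distance $d$* and decoder constant $\kappa$ is a procedure that adjoins finitely many ancillary sites in a product state and then applies finitely many layers of local operations (local rotations, stabilizer measurements, local decoding by feed-forward, coarse-graining). That is, layer $k$ consists of quantum channels acting on pairwise disjoint sets of sites of diameter at most $r_k$, with $\sum_k r_k\le\kappa d$. **Theorem.** There are absolute constants $c>0$, $\varepsilon_0>0$ and $N_0\in\mathbb N$ such that the following holds. Let $\rho$ be an arbitrary input state of a system on a surface, and let $\rho_f$ be the state of system and ancillas obtained from $\rho$ by LED with correction distance $d$ and decoder constant $\kappa$. Suppose that $\rho_f$ has as a subsystem qubits living on the links of an $N\times N$ patch of a square lattice of lattice spacing $a>0$, where $N\ge N_0$; that is, any two links $e,e'$ of the patch are at distance at least $a\,\|e-e'\|_\infty$ on the surface, where $\|e-e'\|_\infty$ is the distance of their midpoints in lattice units. Let $A_v=\prod_{i\ni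 v}X_i$ and $B_p=\prod_{i\in\partial p}Z_i$ be the toric-code stabilizers, let $0<\varepsilon\le\varepsilon_0$, and suppose that $$\Big\langle\tfrac{1+A_v}{2}\Big\rangle_{\rho_f}>1-\varepsilon,\qquad \Big\langle\tfrac{1+B_p}{2}\Big\rangle_{\rho_f}>1-\varepsilon$$ for every vertex $v$ all four of whose links belong to the patch and for every plaquette $p$ of the patch. Put $\mathscr L=a\min(N,1/\sqrt\varepsilon)$. Then, for every $r>0$, no purification of $\rho$ (with purifying sites placed anywhere on the surface) can be prepared from a product state by a local quantum circuit with gates of diameter at most $r$ whose depth is less than $$\frac{c\,\mathscr L-\kappa d}{r}.$$ -/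

import Mathlib

open scoped Matrix ComplexOrder

noncomputable section

namespace LEDWitness

/-! ### Many-body quantum systems on a surface -/

/-- A finite collection of quantum degrees of freedom located on a surface, modelled by a (pseudo)metric
space `M`. Site `i` sits at the point `pos i` and has the local Hilbert space `ℂ ^ dim i`. Several sites
may sit at the same point. -/
structure SiteSystem (M : Type*) where
  Site : Type
  [fintypeSite : Fintype Site]
  [decEqSite : DecidableEq Site]
  pos : Site → M
  dim : Site → ℕ

attribute [instance] SiteSystem.fintypeSite SiteSystem.decEqSite

variable {M : Type*}

/-- Labels of the computational basis of `⨂ i, ℂ ^ dim i`. -/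
abbrev SiteSystem.Config (S : SiteSystem M) : Type := ∀ i : S.Site, Fin (S.dim i)

/-- State vectors, in the computational basis. -/
abbrev SiteSystem.Vec (S : SiteSystem M) : Type := S.Config → ℂ

/-- Operators, in the computational basis. -/
abbrev SiteSystem.Op (S : SiteSystem M) : Type := Matrix S.Config S.Config ℂ

/-- The joint system made of the sites of `S` and the sites of `T`. -/
def SiteSystem.append (S T : SiteSystem M) : SiteSystem M where
  Site := S.Site ⊕ T.Site
  pos := Sum.elim S.pos T.pos
  dim := Sum.elim S.dim T.dim

/-- The `S`-part of a basis label of the joint system. -/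
def configLeft {S T : SiteSystem M} (σ : (S.append T).Config) : S.Config := fun i => σ (Sum.inl i)

/-- The `T`-part of a basis label of the joint system. -/
def configRight {S T : SiteSystem M} (σ : (S.append T).Config) : T.Config := fun i => σ (Sum.inr i)

/-- The basis label of the joint system with the given `S`-part and `T`-part. -/
def configJoin {S T : SiteSystem M} (σ : S.Config) (η : T.Config) : (S.append T).Config
  | Sum.inl i => σ i
  | Sum.inr i => η i

/-- Density matrices. -/
def IsDensity {S : SiteSystem M} (ρ : S.Op) : Prop := ρ.PosSemidef ∧ ρ.trace = 1

/-- The rank-one operator `|ψ⟩⟨ψ|`. -/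
def ketBra {S : SiteSystem M} (ψ : S.Vec) : S.Op := Matrix.vecMulVec ψ (star ψ)

/-- The partial trace over `T`. -/
def partialTrace {S T : SiteSystem M} (ρ : (S.append T).Op) : S.Op :=
  fun σ τ => ∑ η : T.Config, ρ (configJoin σ η) (configJoin τ η)

/-- The tensor product `ρ ⊗ ω` on the joint system. -/
def tensorOp {S T : SiteSystem M} (ρ : S.Op) (ω : T.Op) : (S.append T).Op :=
  fun σ τ => ρ (configLeft σ) (configLeft τ) * ω (configRight σ) (configRight τ)

/-- The product vector `⨂ i, φ i`. -/
def productVec {S : SiteSystem M} (φ : ∀ i : S.Site, Fin (S.dim i) → ℂ) : S.Vec :=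
  fun σ => ∏ i, φ i (σ i)

/-- `ψ` is a product state: a tensor product of one unit vector per site. -/
def IsProductState {S : SiteSystem M} (ψ : S.Vec) : Prop :=
  ∃ φ : ∀ i : S.Site, Fin (S.dim i) → ℂ, (∀ i, ∑ s, ‖φ i s‖ ^ 2 = 1) ∧ ψ = productVec φ

/-- The operator `K` acts only on the sites in `X`, that is, `K = K_X ⊗ 1`. -/
def SupportedOn {S : SiteSystem M} (X : Set S.Site) (K : S.Op) : Prop :=
  (∀ σ τ : S.Config, (∃ i, i ∉ X ∧ σ i ≠ τ i) → K σ τ = 0) ∧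
  (∀ σ τ σ' τ' : S.Config, (∀ i ∈ X, σ i = σ' i ∧ τ i = τ' i) →
    (∀ i, i ∉ X → σ i = τ i) → (∀ i, i ∉ X → σ' i = τ' i) → K σ τ = K σ' τ')

/-! ### Local circuits and local procedures -/

section Locality

variable [PseudoMetricSpace M]

/-- Any two sites in `X` are at distance at most `r`. -/
def HasDiam {S : SiteSystem M} (X : Set S.Site) (r : ℝ) : Prop :=
  ∀ i ∈ X, ∀ j ∈ X, dist (S.pos i) (S.pos j) ≤ r

/-- One layer of a local unitary circuit: unitary gates acting on pairwise disjoint sets of sites of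
diameter at most `r`. -/
def IsUnitaryLayer {S : SiteSystem M} (r : ℝ) (V : S.Op) : Prop :=
  ∃ gates : List (Set S.Site × S.Op),
    gates.Pairwise (fun g h => Disjoint g.1 h.1) ∧
    (∀ g ∈ gates, HasDiam g.1 r ∧ SupportedOn g.1 g.2 ∧ g.2 ∈ Matrix.unitaryGroup S.Config ℂ) ∧
    V = (gates.map Prod.snd).prod

/-- `U` is a local quantum circuit of depth `D` with gates of diameter at most `r`. -/
inductive IsCircuit {S : SiteSystem M} (r : ℝ) : ℕ → S.Op → Prop
  | nil : IsCircuit r 0 1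
  | step {D : ℕ} {U V : S.Op} : IsUnitaryLayer r V → IsCircuit r D U → IsCircuit r (D + 1) (V * U)

/-- `Φ` is a quantum channel acting only on the sites in `X`: it is completely positive and trace
preserving, with Kraus operators that act only on `X`. -/
def IsLocalChannel {S : SiteSystem M} (X : Set S.Site) (Φ : S.Op → S.Op) : Prop :=
  ∃ (m : ℕ) (K : Fin m → S.Op), (∀ k, SupportedOn X (K k)) ∧ ∑ k, (K k)ᴴ * K k = 1 ∧
    ∀ ρ, Φ ρ = ∑ k, K k * ρ * (K k)ᴴ

/-- One layer of a local procedure: quantum channels (unitary gates, measurements whose outcomes are kept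
in local registers, operations controlled by local registers, resets, ...) acting on pairwise disjoint
sets of sites of diameter at most `r`. -/
def IsChannelLayer {S : SiteSystem M} (r : ℝ) (Φ : S.Op → S.Op) : Prop :=
  ∃ blocks : List (Set S.Site × (S.Op → S.Op)),
    blocks.Pairwise (fun g h => Disjoint g.1 h.1) ∧
    (∀ g ∈ blocks, HasDiam g.1 r ∧ IsLocalChannel g.1 g.2) ∧
    Φ = (blocks.map Prod.snd).foldr (fun f g => f ∘ g) id

/-- `Φ` is a finite sequence of layers of local channels; layer `k` consists of channels on disjoint sets
of diameter at most `r k`, and `R = ∑ k, r k` bounds the distance over which information propagates.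
The ranges may differ between layers, as for a circuit that works on successively coarser lattices. -/
inductive IsLocalProcedure {S : SiteSystem M} : ℝ → (S.Op → S.Op) → Prop
  | nil : IsLocalProcedure 0 id
  | step {R r : ℝ} {Φ Ψ : S.Op → S.Op} : 0 ≤ r → IsChannelLayer r Ψ → IsLocalProcedure R Φ →
      IsLocalProcedure (R + r) (Ψ ∘ Φ)

/-- Locally error-corrected decoration (LED) with correction distance `d` on the system `S`: product-state
ancillas are placed on the surface, and then layers of local operations are applied to system and ancillas
(local rotations, stabilizer measurements, local decoding by feed-forward, coarse-graining). Its range of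
information propagation is at most `κ * d`, where `κ` is a constant of the decoder. Degrees of freedom that
LED removes need not be discarded: the lattice on which the result is read out is any subsystem of the
output. -/
structure LED (S : SiteSystem M) (κ d : ℝ) where
  anc : SiteSystem M
  ancState : anc.Vec
  ancState_product : IsProductState ancState
  channel : (S.append anc).Op → (S.append anc).Op
  range : ℝ
  range_le : range ≤ κ * d
  isLocal : IsLocalProcedure range channel

/-- The state that LED produces from the input state `ρ`. -/
def LED.output {S : SiteSystem M} {κ d : ℝ} (P : LED S κ d) (ρ : S.Op) : (S.append P.anc).Op :=
  P.channel (tensorOp ρ (ketBra P.ancState))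

/-- Some purification of `ρ`, with purifying degrees of freedom placed anywhere on the surface, is prepared
from a product state by a local quantum circuit of depth `D` with gates of diameter at most `r`. -/
def HasPurificationOfDepth {S : SiteSystem M} (ρ : S.Op) (r : ℝ) (D : ℕ) : Prop :=
  ∃ (E : SiteSystem M) (ψ₀ : (S.append E).Vec) (U : (S.append E).Op),
    IsProductState ψ₀ ∧ IsCircuit r D U ∧ partialTrace (ketBra (U *ᵥ ψ₀)) = ρ

end Locality

/-! ### The toric code on a patch of the square lattice -/

/-- The links of the square lattice with vertices `(x, y)`, `0 ≤ x, y ≤ N`: `Sum.inl (x, y)` is the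
horizontal link from `(x, y)` to `(x + 1, y)`, and `Sum.inr (x, y)` is the vertical link from `(x, y)` to
`(x, y + 1)`. -/
abbrev Link (N : ℕ) : Type := (Fin N × Fin (N + 1)) ⊕ (Fin (N + 1) × Fin N)

/-- The midpoint of a link. -/
def Link.mid {N : ℕ} : Link N → ℝ × ℝ
  | Sum.inl (x, y) => ((x : ℝ) + 1 / 2, (y : ℝ))
  | Sum.inr (x, y) => ((x : ℝ), (y : ℝ) + 1 / 2)

/-- The vertex `v` is an endpoint of the link. -/
def Link.Touches {N : ℕ} : Link N → Fin (N + 1) × Fin (N + 1) → Prop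
  | Sum.inl (x, y), v => (v.1 = x.castSucc ∨ v.1 = x.succ) ∧ v.2 = y
  | Sum.inr (x, y), v => v.1 = x ∧ (v.2 = y.castSucc ∨ v.2 = y.succ)

/-- The links that touch the vertex `v`. -/
def vertexStar {N : ℕ} (v : Fin (N + 1) × Fin (N + 1)) : Set (Link N) :=
  {e | Link.Touches e v}

/-- `v` is an inner vertex, that is, all four of its links belong to the patch. -/
def IsInner {N : ℕ} (v : Fin (N + 1) × Fin (N + 1)) : Prop :=
  (0 < (v.1 : ℕ) ∧ (v.1 : ℕ) < N) ∧ (0 < (v.2 : ℕ) ∧ (v.2 : ℕ) < N)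

/-- The four links around the plaquette whose lower left corner is `p`. -/
def plaquette {N : ℕ} (p : Fin N × Fin N) : Set (Link N) :=
  {Sum.inl (p.1, p.2.castSucc), Sum.inl (p.1, p.2.succ),
    Sum.inr (p.1.castSucc, p.2), Sum.inr (p.1.succ, p.2)}

/-- The system `T` contains qubits on the links of an `N × N` patch of a square lattice with lattice
spacing `a`: the distance on the surface of two links is at least `a` times their distance in the lattice
(measured with `max (|Δx|, |Δy|)`). -/
structure LatticePatch [PseudoMetricSpace M] (T : SiteSystem M) (N : ℕ) (a : ℝ) where
  site : Link N → T.Site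
  isQubit : ∀ e, T.dim (site e) = 2
  spacing : ∀ e e', a * dist (Link.mid e) (Link.mid e') ≤ dist (T.pos (site e)) (T.pos (site e'))

open Classical in
/-- The operator `∏ i ∈ Y, X_i` for a set `Y` of qubits. -/
def pauliX {S : SiteSystem M} (Y : Set S.Site) : S.Op :=
  fun σ τ => if (∀ i ∈ Y, σ i ≠ τ i) ∧ (∀ i, i ∉ Y → σ i = τ i) then 1 else 0

open Classical in
/-- The operator `∏ i ∈ Y, Z_i` for a set `Y` of qubits. -/
def pauliZ {S : SiteSystem M} (Y : Set S.Site) : S.Op :=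
  Matrix.diagonal fun σ => ∏ i, if i ∈ Y then (-1 : ℂ) ^ (σ i : ℕ) else 1

/-- The vertex stabilizer `A_v`. -/
def vertexOp [PseudoMetricSpace M] {T : SiteSystem M} {N : ℕ} {a : ℝ} (L : LatticePatch T N a)
    (v : Fin (N + 1) × Fin (N + 1)) : T.Op :=
  pauliX (L.site '' vertexStar v)

/-- The plaquette stabilizer `B_p`. -/
def plaquetteOp [PseudoMetricSpace M] {T : SiteSystem M} {N : ℕ} {a : ℝ} (L : LatticePatch T N a)
    (p : Fin N × Fin N) : T.Op :=
  pauliZ (L.site '' plaquette p)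

/-- The expectation value of `(1 + O) / 2` in the state `ρ`. -/
def projExpectation {S : SiteSystem M} (ρ : S.Op) (O : S.Op) : ℝ :=
  ((ρ * ((1 / 2 : ℂ) • (1 + O))).trace).re

end LEDWitness

end

open scoped Matrix ComplexOrder

noncomputable section

namespace LEDWitness

variable {M : Type*}

/-! ### Calculus of supports -/

namespace SupportedOn

variable {S : SiteSystem M} {X Y : Set S.Site} {K L : S.Op}

/-! The obstruction is topological order: on a patch, the toric code has closed X- and Z-loops with
value near 1, while half of the X-loop anticommutes with the Z-loop. A state whose observables
depend only on nearby parts of a product state cannot reproduce this.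

The locality half works in the Heisenberg picture. `HasConeModel` replaces expectation values in
`ρ_f` by those in a product vector `Ω`, through a star homomorphism `π` that enlarges supports only
within cones. Product ancillas and partial traces preserve such models (`HasConeModel.tensor`,
`HasConeModel.of_partialTrace`). A local channel becomes a local unitary with one extra ancilla
(`HasConeModel.localChannel`), so each layer enlarges the cones by its range. For a circuit of depth
`D` followed by LED the total radius is at most `D * r + κ * d`.

For the contradiction, write the X-loop as `R * P`, with `P` its upper arc, and let `L` be the
Z-loop, which crosses that arc exactly once. Since `R * P` nearly fixes `Ω`, the vector `P Ω` still
looks like the product state away from the overlap of the cones of `P` and `R`, that is, away from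
the ends of the arc. If the cones are small, `L` avoids that overlap, so `P Ω` and `Ω` must give `L`
nearly the same value. Anticommutation instead reverses its sign. This is
`IsProductState.false_of_anticommute`; `not_close_of_mem` supplies the geometry.

A loop of linear size `m` is a product of order `m ^ 2` stabilizers, each with a defect of order
`ε`. Hence `m` may grow to order `min (N, 1 / √ε)`, and the radius must be at least of order `a *
m`. -/

theorem mono (hXY : X ⊆ Y) (hK : SupportedOn X K) : SupportedOn Y K := by
  refine ⟨fun σ τ ⟨i, hi, h⟩ => hK.1 σ τ ⟨i, fun h' => hi (hXY h'), h⟩, ?_⟩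
  intro σ τ σ' τ' h1 h2 h3
  by_cases h : ∀ i, i ∉ X → σ i = τ i
  · refine hK.2 σ τ σ' τ' (fun i hi => h1 i (hXY hi)) h fun i hi => ?_
    by_cases hiY : i ∈ Y
    · rw [← (h1 i hiY).1, ← (h1 i hiY).2]; exact h i hi
    · exact h3 i hiY
  · push Not at h
    obtain ⟨i, hi, hne⟩ := h
    have hiY : i ∈ Y := by
      by_contra hiY
      exact hne (h2 i hiY)
    rw [hK.1 σ τ ⟨i, hi, hne⟩, hK.1 σ' τ' ⟨i, hi, by rwa [← (h1 i hiY).1, ← (h1 i hiY).2]⟩]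

theorem zero : SupportedOn X (0 : S.Op) := ⟨fun _ _ _ => rfl, fun _ _ _ _ _ _ _ => rfl⟩

theorem one : SupportedOn X (1 : S.Op) := by
  refine ⟨fun σ τ ⟨i, _, h⟩ => Matrix.one_apply_ne fun h' => h (by rw [h']), ?_⟩
  intro σ τ σ' τ' h1 h2 h3
  have : σ = τ ↔ σ' = τ' := by
    constructor <;> intro h <;> funext i <;> by_cases hi : i ∈ X
    · rw [← (h1 i hi).1, ← (h1 i hi).2, h]
    · exact h3 i hi
    · rw [(h1 i hi).1, (h1 i hi).2, h]
    · exact h2 i hi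
  simp [Matrix.one_apply, this]

theorem smul (a : ℂ) (hK : SupportedOn X K) : SupportedOn X (a • K) := by
  refine ⟨fun σ τ h => by simp [hK.1 σ τ h], fun σ τ σ' τ' h1 h2 h3 => ?_⟩
  simp [hK.2 σ τ σ' τ' h1 h2 h3]

theorem sub (hK : SupportedOn X K) (hL : SupportedOn X L) : SupportedOn X (K - L) := by
  refine ⟨fun σ τ h => by simp [hK.1 σ τ h, hL.1 σ τ h], fun σ τ σ' τ' h1 h2 h3 => ?_⟩
  simp [hK.2 σ τ σ' τ' h1 h2 h3, hL.2 σ τ σ' τ' h1 h2 h3]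

theorem star (hK : SupportedOn X K) : SupportedOn X (star K) := by
  refine ⟨fun σ τ ⟨i, hi, h⟩ => ?_, fun σ τ σ' τ' h1 h2 h3 => ?_⟩
  · simp [Matrix.star_apply, hK.1 τ σ ⟨i, hi, h.symm⟩]
  · simp only [Matrix.star_apply]
    rw [hK.2 τ σ τ' σ' (fun i hi => (h1 i hi).symm) (fun i hi => (h2 i hi).symm)
      fun i hi => (h3 i hi).symm]

theorem mul (hK : SupportedOn X K) (hL : SupportedOn X L) : SupportedOn X (K * L) := by
  classical
  refine ⟨fun σ τ ⟨i, hi, h⟩ => ?_, fun σ τ σ' τ' h1 h2 h3 => ?_⟩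
  · rw [Matrix.mul_apply]
    refine Finset.sum_eq_zero fun μ _ => ?_
    by_cases hμ : σ i = μ i
    · rw [hL.1 μ τ ⟨i, hi, by rwa [← hμ]⟩, mul_zero]
    · rw [hK.1 σ μ ⟨i, hi, hμ⟩, zero_mul]
  · rw [Matrix.mul_apply, Matrix.mul_apply]
    -- Reindex the sum over intermediate labels: nothing changes on `X`, and off `X` the spectator
    -- value of `σ` is exchanged with that of `σ'`. Labels that leave the spectator value contribute
    -- zero on both sides.
    let e : S.Config ≃ S.Config := Equiv.piCongrRight fun i =>
      if i ∈ X then Equiv.refl _ else Equiv.swap (σ i) (σ' i)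
    have eX : ∀ μ i, i ∈ X → e μ i = μ i := fun μ i hi => by simp [e, hi]
    have eN : ∀ μ i, i ∉ X → e μ i = Equiv.swap (σ i) (σ' i) (μ i) := fun μ i hi => by
      simp [e, hi]
    have key : ∀ μ i, i ∉ X → (μ i = σ i ↔ e μ i = σ' i) := fun μ i hi => by
      rw [eN μ i hi, Equiv.swap_apply_eq_iff, Equiv.swap_apply_right]
    refine Fintype.sum_equiv e _ _ fun μ => ?_
    by_cases hμ : ∀ i, i ∉ X → μ i = σ i
    · rw [hK.2 σ μ σ' (e μ) (fun i hi => ⟨(h1 i hi).1, (eX μ i hi).symm⟩)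
        (fun i hi => (hμ i hi).symm) (fun i hi => ((key μ i hi).1 (hμ i hi)).symm),
        hL.2 μ τ (e μ) τ' (fun i hi => ⟨(eX μ i hi).symm, (h1 i hi).2⟩)
        (fun i hi => (hμ i hi).trans (h2 i hi))
        (fun i hi => ((key μ i hi).1 (hμ i hi)).trans (h3 i hi))]
    · push Not at hμ
      obtain ⟨i, hi, hne⟩ := hμ
      rw [hK.1 σ μ ⟨i, hi, fun h => hne h.symm⟩,
        hK.1 σ' (e μ) ⟨i, hi, fun h => hne ((key μ i hi).2 h.symm)⟩]
      simp

-- A single intermediate label survives: `L` is diagonal on `X`, which forces the value of `τ`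
-- there, and `K` is diagonal off `X`, which forces the value of `σ`.
open Classical in
theorem mul_apply_of_disjoint (hXY : Disjoint X Y) (hK : SupportedOn X K) (hL : SupportedOn Y L)
    (σ τ : S.Config) :
    (K * L) σ τ = K σ (X.piecewise τ σ) * L (X.piecewise τ σ) τ := by
  rw [Matrix.mul_apply]
  refine Finset.sum_eq_single _ (fun μ _ hμ => ?_) (by simp)
  obtain ⟨i, hi⟩ := Function.ne_iff.1 hμ
  by_cases hX : i ∈ X
  · rw [Set.piecewise_eq_of_mem _ _ _ hX] at hi
    rw [hL.1 μ τ ⟨i, Set.disjoint_left.1 hXY hX, hi⟩, mul_zero]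
  · rw [Set.piecewise_eq_of_notMem _ _ _ hX] at hi
    rw [hK.1 σ μ ⟨i, hX, fun h => hi h.symm⟩, zero_mul]

theorem commute (hXY : Disjoint X Y) (hK : SupportedOn X K) (hL : SupportedOn Y L) :
    Commute K L := by
  classical
  ext σ τ
  rw [mul_apply_of_disjoint hXY hK hL, mul_apply_of_disjoint hXY.symm hL hK]
  by_cases h : ∃ i, i ∉ X ∧ i ∉ Y ∧ σ i ≠ τ i
  · obtain ⟨i, hX, hY, hne⟩ := h
    rw [hL.1 _ τ ⟨i, hY, by rwa [Set.piecewise_eq_of_notMem _ _ _ hX]⟩,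
      hK.1 _ τ ⟨i, hX, by rwa [Set.piecewise_eq_of_notMem _ _ _ hY]⟩, mul_zero, mul_zero]
  · push Not at h
    have hd : ∀ i, i ∈ X → i ∉ Y := fun i hi => Set.disjoint_left.1 hXY hi
    rw [mul_comm]
    congr 1
    · refine hL.2 _ _ _ _ (fun i hi => ?_) (fun i hi => ?_) (fun i hi => ?_)
      · have : i ∉ X := fun h' => hd i h' hi
        simp [Set.piecewise, hi, this]
      · by_cases hX : i ∈ X <;> simp [Set.piecewise, hX, h i, hi]
      · by_cases hX : i ∈ X <;> simp [Set.piecewise, hi]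
    · refine hK.2 _ _ _ _ (fun i hi => ?_) (fun i hi => ?_) (fun i hi => ?_)
      · simp [Set.piecewise, hi, hd i hi]
      · by_cases hY : i ∈ Y <;> simp [Set.piecewise, hi]
      · by_cases hY : i ∈ Y <;> simp [Set.piecewise, hY, h i hi]

/-- The tensor product of nonzero operators on complementary sets of sites does not vanish. -/
theorem eq_zero_of_mul_eq_zero (hK : SupportedOn X K) (hL : SupportedOn Xᶜ L) (h : K * L = 0)
    (hK0 : K ≠ 0) : L = 0 := by
  classical
  obtain ⟨γ, δ, hγδ⟩ : ∃ γ δ, K γ δ ≠ 0 := by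
    by_contra! h'
    exact hK0 (by ext σ τ; exact h' σ τ)
  ext α β
  by_contra hαβ
  rw [Matrix.zero_apply] at hαβ
  have h1 : ∀ i ∉ X, γ i = δ i := fun i hi => by
    by_contra hne
    exact hγδ (hK.1 _ _ ⟨i, hi, hne⟩)
  have h2 : ∀ i ∈ X, α i = β i := fun i hi => by
    by_contra hne
    exact hαβ (hL.1 _ _ ⟨i, by simpa using hi, hne⟩)
  -- At the labels glued from `γ, δ` on `X` and `α, β` off `X`, the entry of the product factors
  -- into the two nonzero entries.
  have h3 := mul_apply_of_disjoint disjoint_compl_right hK hL (X.piecewise γ α) (X.piecewise δ β)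
  rw [h, Matrix.zero_apply] at h3
  refine mul_ne_zero hγδ hαβ (Eq.trans ?_ h3.symm)
  congr 1
  · refine hK.2 _ _ _ _ (fun i hi => by simp [Set.piecewise, hi]) h1 (fun i hi => ?_)
    simp [Set.piecewise, hi]
  · refine hL.2 _ _ _ _ (fun i hi => ?_) (fun i hi => h2 i (by simpa using hi)) (fun i hi => ?_)
    · have : i ∉ X := hi
      simp [Set.piecewise, this]
    · have : i ∈ X := by simpa using hi
      simp [Set.piecewise, this]

end SupportedOn

/-! ### Block operators on joint systems -/

section Blocks

variable {S A : SiteSystem M}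

/-- Basis labels of a joint system are pairs of basis labels. -/
def configEquiv (S A : SiteSystem M) : (S.append A).Config ≃ S.Config × A.Config where
  toFun σ := (configLeft σ, configRight σ)
  invFun p := configJoin p.1 p.2
  left_inv σ := by funext i; cases i <;> rfl
  right_inv p := rfl

theorem configJoin_left_right (σ : (S.append A).Config) :
    configJoin (configLeft σ) (configRight σ) = σ := (configEquiv S A).left_inv σ

@[simp] theorem configLeft_configJoin (σ : S.Config) (η : A.Config) :
    configLeft (configJoin σ η) = σ := rfl

@[simp] theorem configRight_configJoin (σ : S.Config) (η : A.Config) :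
    configRight (configJoin σ η) = η := rfl

theorem config_eq_iff {σ τ : (S.append A).Config} :
    σ = τ ↔ configLeft σ = configLeft τ ∧ configRight σ = configRight τ := by
  rw [← (configEquiv S A).apply_eq_iff_eq, Prod.ext_iff]; rfl

theorem sum_config {β : Type*} [AddCommMonoid β] (f : (S.append A).Config → β) :
    ∑ σ, f σ = ∑ η : A.Config, ∑ σ : S.Config, f (configJoin σ η) := by
  rw [← (configEquiv S A).symm.sum_comp f, Fintype.sum_prod_type_right]; rfl

/-- The operator on the joint system with the given matrix of operators on `S`. -/
def ofBlocks (G : Matrix A.Config A.Config S.Op) : (S.append A).Op :=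
  fun σ τ => G (configRight σ) (configRight τ) (configLeft σ) (configLeft τ)

/-- The matrix of operators on `S` that describes an operator on the joint system. -/
def blocks (O : (S.append A).Op) : Matrix A.Config A.Config S.Op :=
  fun η ξ σ τ => O (configJoin σ η) (configJoin τ ξ)

theorem ofBlocks_blocks (O : (S.append A).Op) : ofBlocks (blocks O) = O := by
  ext σ τ
  simp [ofBlocks, blocks, configJoin_left_right]

theorem blocks_ofBlocks (G : Matrix A.Config A.Config S.Op) : blocks (ofBlocks G) = G := rfl

theorem ofBlocks_mul (G H : Matrix A.Config A.Config S.Op) :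
    ofBlocks (G * H) = ofBlocks G * ofBlocks H := by
  ext σ τ
  simp only [ofBlocks, Matrix.mul_apply, sum_config, configLeft_configJoin,
    configRight_configJoin, Matrix.sum_apply]

theorem ofBlocks_one : ofBlocks (1 : Matrix A.Config A.Config S.Op) = 1 := by
  ext σ τ
  simp only [ofBlocks, Matrix.one_apply, config_eq_iff]
  by_cases h : configRight σ = configRight τ
  · simp [h, Matrix.one_apply]
  · simp [h]

theorem ofBlocks_star (G : Matrix A.Config A.Config S.Op) :
    ofBlocks (star G) = star (ofBlocks G) := by
  ext σ τ
  simp [ofBlocks, Matrix.star_apply]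

theorem blocks_mul (O O' : (S.append A).Op) : blocks (O * O') = blocks O * blocks O' := by
  rw [← blocks_ofBlocks (blocks O * blocks O'), ofBlocks_mul, ofBlocks_blocks, ofBlocks_blocks]

theorem blocks_one : blocks (1 : (S.append A).Op) = 1 := by
  rw [← ofBlocks_one, blocks_ofBlocks]

theorem blocks_star (O : (S.append A).Op) : blocks (star O) = star (blocks O) := by
  rw [← blocks_ofBlocks (star (blocks O)), ofBlocks_star, ofBlocks_blocks]

theorem partialTrace_eq (O : (S.append A).Op) : partialTrace O = ∑ η, blocks O η η := by
  ext σ τ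
  simp [partialTrace, blocks, Matrix.sum_apply]

theorem trace_eq (O : (S.append A).Op) : O.trace = ∑ η, (blocks O η η).trace := by
  simp only [Matrix.trace, sum_config, blocks, Matrix.diag_apply]

theorem blocks_tensorOp (ρ : S.Op) (ω : A.Op) (η ξ : A.Config) :
    blocks (tensorOp ρ ω) η ξ = ω η ξ • ρ := by
  ext σ τ
  simp [blocks, tensorOp, mul_comm]

theorem inl_mem_union {ι κ : Type*} {X : Set ι} {Y : Set κ} {i : ι} :
    (Sum.inl i : ι ⊕ κ) ∈ Sum.inl '' X ∪ Sum.inr '' Y ↔ i ∈ X := by simp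

theorem inr_mem_union {ι κ : Type*} {X : Set ι} {Y : Set κ} {i : κ} :
    (Sum.inr i : ι ⊕ κ) ∈ Sum.inl '' X ∪ Sum.inr '' Y ↔ i ∈ Y := by simp

theorem SupportedOn.ofBlocks {X : Set S.Site} {Y : Set A.Site}
    {G : Matrix A.Config A.Config S.Op} (hG : ∀ η ξ, SupportedOn X (G η ξ))
    (h0 : ∀ η ξ, (∃ i, i ∉ Y ∧ η i ≠ ξ i) → G η ξ = 0)
    (h1 : ∀ η ξ η' ξ' : A.Config, (∀ i ∈ Y, η i = η' i ∧ ξ i = ξ' i) →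
      (∀ i, i ∉ Y → η i = ξ i) → (∀ i, i ∉ Y → η' i = ξ' i) → G η ξ = G η' ξ') :
    SupportedOn (S := S.append A) (Sum.inl '' X ∪ Sum.inr '' Y) (ofBlocks G) := by
  constructor
  · rintro σ τ ⟨i | i, hi, hne⟩
    · exact (hG _ _).1 _ _ ⟨i, fun h => hi (Or.inl ⟨i, h, rfl⟩), hne⟩
    · have := h0 (configRight σ) (configRight τ) ⟨i, fun h => hi (Or.inr ⟨i, h, rfl⟩), hne⟩
      simp [LEDWitness.ofBlocks, this]
  · intro σ τ σ' τ' ha hb hc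
    unfold LEDWitness.ofBlocks
    rw [h1 (configRight σ) (configRight τ) (configRight σ') (configRight τ')
      (fun i hi => ha _ (Or.inr ⟨i, hi, rfl⟩))
      (fun i hi => hb (Sum.inr i) (mt inr_mem_union.1 hi))
      (fun i hi => hc (Sum.inr i) (mt inr_mem_union.1 hi))]
    exact (hG _ _).2 _ _ _ _ (fun i hi => ha _ (Or.inl ⟨i, hi, rfl⟩))
      (fun i hi => hb (Sum.inl i) (mt inl_mem_union.1 hi))
      (fun i hi => hc (Sum.inl i) (mt inl_mem_union.1 hi))

/-- The converse of `SupportedOn.ofBlocks`: support in a joint system can be read off block by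
block. This lets `tensorHom`, which acts on each block separately, inherit the support bounds of
`π`. -/
theorem SupportedOn.blocks {Z : Set (S.append A).Site} {O : (S.append A).Op}
    (hO : SupportedOn Z O) :
    (∀ η ξ, SupportedOn (Sum.inl ⁻¹' Z) (blocks O η ξ)) ∧
    (∀ η ξ, (∃ i, Sum.inr i ∉ Z ∧ η i ≠ ξ i) → LEDWitness.blocks O η ξ = 0) ∧
    (∀ η ξ η' ξ' : A.Config, (∀ i, Sum.inr i ∈ Z → η i = η' i ∧ ξ i = ξ' i) →
      (∀ i, Sum.inr i ∉ Z → η i = ξ i) → (∀ i, Sum.inr i ∉ Z → η' i = ξ' i) →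
      LEDWitness.blocks O η ξ = LEDWitness.blocks O η' ξ') := by
  have h0 : ∀ η ξ, (∃ i, Sum.inr i ∉ Z ∧ η i ≠ ξ i) → LEDWitness.blocks O η ξ = 0 := by
    rintro η ξ ⟨i, hi, hne⟩
    ext σ τ
    exact hO.1 _ _ ⟨Sum.inr i, hi, hne⟩
  refine ⟨fun η ξ => ⟨?_, ?_⟩, h0, ?_⟩
  · rintro σ τ ⟨i, hi, hne⟩
    exact hO.1 _ _ ⟨Sum.inl i, hi, hne⟩
  · intro σ τ σ' τ' ha hb hc
    by_cases h : ∃ i, Sum.inr i ∉ Z ∧ η i ≠ ξ i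
    · rw [h0 η ξ h]; rfl
    · push Not at h
      refine hO.2 _ _ _ _ ?_ ?_ ?_ <;> rintro (i | i) hi
      · exact ha i hi
      · exact ⟨rfl, rfl⟩
      · exact hb i hi
      · exact h i hi
      · exact hc i hi
      · exact h i hi
  · intro η ξ η' ξ' ha hb hc
    ext σ τ
    by_cases h : ∃ i, Sum.inl i ∉ Z ∧ σ i ≠ τ i
    · obtain ⟨i, hi, hne⟩ := h
      exact (hO.1 (configJoin σ η) (configJoin τ ξ) ⟨Sum.inl i, hi, hne⟩).trans
        (hO.1 (configJoin σ η') (configJoin τ ξ') ⟨Sum.inl i, hi, hne⟩).symm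
    · push Not at h
      refine hO.2 _ _ _ _ ?_ ?_ ?_ <;> rintro (i | i) hi
      · exact ⟨rfl, rfl⟩
      · exact ha i hi
      · exact h i hi
      · exact hb i hi
      · exact h i hi
      · exact hc i hi

end Blocks

/-! ### Dependency cones in the Heisenberg picture -/

/-- The state `ρ` arises from a product state in such a way that, in the Heisenberg picture, an operator
on the site `i` only depends on the initial degrees of freedom that sit in `c i`. -/
def HasConeModel {T : SiteSystem M} (c : T.Site → Set M) (ρ : T.Op) : Prop :=
  ∃ (F : SiteSystem M) (Ω : F.Vec) (π : T.Op →⋆ₐ[ℂ] F.Op), IsProductState Ω ∧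
    (∀ X O, SupportedOn X O → SupportedOn {i | ∃ x ∈ X, F.pos i ∈ c x} (π O)) ∧
    ∀ O, star Ω ⬝ᵥ (π O *ᵥ Ω) = (ρ * O).trace

namespace HasConeModel

theorem mono {T : SiteSystem M} {c c' : T.Site → Set M} {ρ : T.Op} (h : HasConeModel c ρ)
    (hc : ∀ i, c i ⊆ c' i) : HasConeModel c' ρ := by
  obtain ⟨F, Ω, π, hΩ, hπ, hE⟩ := h
  refine ⟨F, Ω, π, hΩ, fun X O hO => (hπ X O hO).mono ?_, hE⟩
  rintro i ⟨x, hx, hi⟩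
  exact ⟨x, hx, hc x hi⟩

theorem of_product {T : SiteSystem M} {ψ : T.Vec} (hψ : IsProductState ψ) :
    HasConeModel (fun i => {T.pos i}) (ketBra ψ) := by
  refine ⟨T, ψ, StarAlgHom.id ℂ _, hψ, fun X O hO => ?_, fun O => ?_⟩
  · change SupportedOn _ O
    exact hO.mono fun i hi => ⟨i, hi, Set.mem_singleton _⟩
  · rw [ketBra, Matrix.vecMulVec_mul, Matrix.trace_vecMulVec, dotProduct_comm ψ,
      ← Matrix.dotProduct_mulVec]
    rfl

/-- Extension of a representation of the operators on `S` to the joint system with `A`. -/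
def tensorHom {S F A : SiteSystem M} (π : S.Op →⋆ₐ[ℂ] F.Op) :
    (S.append A).Op →⋆ₐ[ℂ] (F.append A).Op where
  toFun O := ofBlocks ((blocks O).map π)
  map_one' := by
    rw [blocks_one, Matrix.map_one _ (map_zero π) (map_one π), ofBlocks_one]
  map_mul' O O' := by
    rw [blocks_mul, Matrix.map_mul, ofBlocks_mul]
  map_zero' := by
    ext σ τ
    change π 0 _ _ = 0
    rw [map_zero]; rfl
  map_add' O O' := by
    ext σ τ
    change π (blocks O _ _ + blocks O' _ _) _ _ = _
    rw [map_add]; rfl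
  commutes' r := by
    ext σ τ
    have h : blocks (algebraMap ℂ (S.append A).Op r) (configRight σ) (configRight τ) =
        r • (1 : Matrix A.Config A.Config S.Op) (configRight σ) (configRight τ) := by
      rw [← blocks_one, Algebra.algebraMap_eq_smul_one]; rfl
    change π (blocks (algebraMap ℂ (S.append A).Op r) _ _) _ _ = _
    rw [h, map_smul, Algebra.algebraMap_eq_smul_one, ← ofBlocks_one]
    simp only [Matrix.smul_apply, ofBlocks, Matrix.one_apply]
    split_ifs <;> simp
  map_star' O := by
    rw [blocks_star, ← ofBlocks_star]
    congr 1
    ext η ξ : 2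
    simp [Matrix.star_apply, map_star]

theorem tensorHom_apply {S F A : SiteSystem M} (π : S.Op →⋆ₐ[ℂ] F.Op) (O : (S.append A).Op) :
    tensorHom π O = ofBlocks ((blocks O).map π) := rfl

theorem _root_.LEDWitness.IsProductState.join {F A : SiteSystem M} {Ω : F.Vec} {α : A.Vec}
    (hΩ : IsProductState Ω) (hα : IsProductState α) :
    IsProductState (S := F.append A) fun σ => Ω (configLeft σ) * α (configRight σ) := by
  obtain ⟨φ, hφ, rfl⟩ := hΩ
  obtain ⟨χ, hχ, rfl⟩ := hα
  refine ⟨fun i => Sum.rec (motive := fun i => Fin ((F.append A).dim i) → ℂ) φ χ i, ?_, ?_⟩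
  · rintro (i | i)
    · exact hφ i
    · exact hχ i
  · funext σ
    exact (Fintype.prod_sum_type fun i : F.Site ⊕ A.Site =>
      Sum.rec (motive := fun i => Fin ((F.append A).dim i) → ℂ) φ χ i (σ i)).symm

theorem expectation_ofBlocks {F A : SiteSystem M} (Ω : F.Vec) (α : A.Vec)
    (G : Matrix A.Config A.Config F.Op) (Ψ : (F.append A).Vec)
    (hΨ : Ψ = fun σ => Ω (configLeft σ) * α (configRight σ)) :
    star Ψ ⬝ᵥ (ofBlocks G *ᵥ Ψ) =
      ∑ η, ∑ ξ, star (α η) * α ξ * (star Ω ⬝ᵥ (G η ξ *ᵥ Ω)) := by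
  subst hΨ
  simp only [dotProduct, Matrix.mulVec, sum_config, ofBlocks, Pi.star_apply,
    configLeft_configJoin, configRight_configJoin, star_mul', Finset.mul_sum]
  refine Finset.sum_congr rfl fun η _ => ?_
  rw [Finset.sum_comm]
  refine Finset.sum_congr rfl fun ξ _ => Finset.sum_congr rfl fun σ _ =>
    Finset.sum_congr rfl fun τ _ => ?_
  ring

/-- The ancillas join the hidden product system unchanged, and `π` is extended by the identity on
them, so an ancilla depends only on its own position. -/
theorem tensor {S A : SiteSystem M} {c : S.Site → Set M} {ρ : S.Op} (h : HasConeModel c ρ)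
    {α : A.Vec} (hα : IsProductState α) :
    HasConeModel (T := S.append A) (Sum.elim c fun i => {A.pos i}) (tensorOp ρ (ketBra α)) := by
  obtain ⟨F, Ω, π, hΩ, hπ, hE⟩ := h
  refine ⟨F.append A, _, tensorHom π, hΩ.join hα, fun Z O hO => ?_, fun O => ?_⟩
  · obtain ⟨h1, h2, h3⟩ := hO.blocks
    refine (SupportedOn.ofBlocks (X := {i | ∃ x ∈ Sum.inl ⁻¹' Z, F.pos i ∈ c x})
      (Y := {i | Sum.inr i ∈ Z}) (G := (blocks O).map π) (fun η ξ => hπ _ _ (h1 η ξ)) ?_ ?_).mono ?_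
    · intro η ξ h
      rw [Matrix.map_apply, h2 η ξ h, map_zero]
    · intro η ξ η' ξ' ha hb hc
      rw [Matrix.map_apply, Matrix.map_apply, h3 η ξ η' ξ' ha hb hc]
    · rintro _ (⟨i, ⟨x, hx, hi⟩, rfl⟩ | ⟨i, hi, rfl⟩)
      · exact ⟨Sum.inl x, hx, hi⟩
      · exact ⟨Sum.inr i, hi, rfl⟩
  · rw [tensorHom_apply, expectation_ofBlocks Ω α _ _ rfl, trace_eq, Finset.sum_comm]
    refine Finset.sum_congr rfl fun η _ => ?_
    rw [blocks_mul, Matrix.mul_apply, Matrix.trace_sum]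
    refine Finset.sum_congr rfl fun ξ _ => ?_
    rw [blocks_tensorOp, smul_mul_assoc, Matrix.trace_smul, Matrix.map_apply, hE, smul_eq_mul,
      ketBra, Matrix.vecMulVec_apply, mul_comm (α η)]
    rfl

/-- Dual to the partial trace is the embedding `O ↦ O ⊗ 1`, which adds no support. The traced-out
sites remain implicit in the hidden system, so no purity is needed for the reduced state. -/
theorem of_partialTrace {S A : SiteSystem M} {c : (S.append A).Site → Set M}
    {ρ : (S.append A).Op} (h : HasConeModel c ρ) :
    HasConeModel (fun i => c (Sum.inl i)) (partialTrace ρ) := by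
  obtain ⟨F, Ω, π, hΩ, hπ, hE⟩ := h
  let ι : S.Op →⋆ₐ[ℂ] (S.append A).Op :=
    { toFun := fun O => ofBlocks (Matrix.scalar _ O)
      map_one' := by rw [map_one, ofBlocks_one]
      map_mul' := fun O O' => by rw [map_mul, ofBlocks_mul]
      map_zero' := by rw [map_zero]; rfl
      map_add' := fun O O' => by rw [map_add]; rfl
      commutes' := fun r => by
        rw [Algebra.algebraMap_eq_smul_one, Algebra.algebraMap_eq_smul_one, ← ofBlocks_one]
        ext σ τ
        by_cases h : configRight σ = configRight τ <;> simp [ofBlocks, Matrix.one_apply, h]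
      map_star' := fun O => by
        rw [← ofBlocks_star]
        congr 1
        ext η ξ : 2
        by_cases h : η = ξ
        · simp [Matrix.star_apply, h]
        · simp [Matrix.star_apply, h, Ne.symm h] }
  refine ⟨F, Ω, π.comp ι, hΩ, fun X O hO => ?_, fun O => ?_⟩
  · refine (hπ _ _ (SupportedOn.ofBlocks (X := X) (Y := ∅) (G := Matrix.scalar _ O) ?_ ?_ ?_)).mono ?_
    · intro η ξ
      by_cases h : η = ξ
      · simpa [h] using hO
      · simpa [h] using SupportedOn.zero
    · rintro η ξ ⟨i, -, hi⟩
      have : η ≠ ξ := fun h => hi (by rw [h])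
      simp [this]
    · intro η ξ η' ξ' _ h1 h2
      have h1 : η = ξ := funext fun i => h1 i (by simp)
      have h2 : η' = ξ' := funext fun i => h2 i (by simp)
      simp [h1, h2]
    · rintro i ⟨_, ⟨x, hx, rfl⟩ | ⟨x, hx, rfl⟩, hi⟩
      · exact ⟨x, hx, hi⟩
      · exact hx.elim
  · change star Ω ⬝ᵥ (π (ofBlocks (Matrix.scalar _ O)) *ᵥ Ω) = _
    rw [hE, trace_eq, partialTrace_eq, Finset.sum_mul, Matrix.trace_sum]
    refine Finset.sum_congr rfl fun η _ => ?_
    rw [blocks_mul, blocks_ofBlocks]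
    simp

/-- Conjugating an observable on `Z` by `U` has no effect if `X` and `Z` are disjoint, and otherwise
spreads it at most to `Z ∪ X`. So only sites of `X` need larger cones, and each of them must absorb
the old cones of all of `X`. -/
theorem unitary_conj {T : SiteSystem M} {c c' : T.Site → Set M} {ρ : T.Op} (h : HasConeModel c ρ)
    {X : Set T.Site} {U : T.Op} (hU : SupportedOn X U) (hU' : U ∈ Matrix.unitaryGroup T.Config ℂ)
    (hc : ∀ i ∉ X, c i ⊆ c' i) (hc' : ∀ i ∈ X, ∀ j ∈ X, c j ⊆ c' i) :
    HasConeModel c' (U * ρ * Uᴴ) := by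
  obtain ⟨F, Ω, π, hΩ, hπ, hE⟩ := h
  let u : unitary T.Op := ⟨U, hU'⟩
  have hu : ∀ O, (Unitary.conjStarAlgAut ℂ T.Op (star u) : T.Op →⋆ₐ[ℂ] T.Op) O = Uᴴ * O * U :=
    fun O => by simp [u, Unitary.conjStarAlgAut_apply, Matrix.star_eq_conjTranspose]
  refine ⟨F, Ω, π.comp (Unitary.conjStarAlgAut ℂ T.Op (star u) : T.Op →⋆ₐ[ℂ] T.Op), hΩ,
    fun Z O hO => ?_, fun O => ?_⟩
  · rw [StarAlgHom.comp_apply, hu]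
    by_cases hZ : Disjoint X Z
    · rw [mul_assoc, ← (SupportedOn.commute hZ hU hO).eq, ← mul_assoc,
        ← Matrix.star_eq_conjTranspose, Matrix.UnitaryGroup.star_mul_self u, one_mul]
      refine (hπ _ _ hO).mono ?_
      rintro i ⟨x, hx, hi⟩
      exact ⟨x, hx, hc x (Set.disjoint_right.1 hZ hx) hi⟩
    · obtain ⟨z, hzX, hzZ⟩ := Set.not_disjoint_iff.1 hZ
      have hU1 := hU.mono (Set.subset_union_right (s := Z))
      refine (hπ _ _ ((hU1.star.mul (hO.mono Set.subset_union_left)).mul hU1)).mono ?_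
      rintro i ⟨x, hx, hi⟩
      by_cases hxX : x ∈ X
      · exact ⟨z, hzZ, hc' z hzX x hxX hi⟩
      · exact ⟨x, hx.resolve_right hxX, hc x hxX hi⟩
  · rw [StarAlgHom.comp_apply, hu, hE, ← mul_assoc, ← mul_assoc,
      Matrix.trace_mul_comm]
    simp only [mul_assoc]

end HasConeModel

/-! ### Dilation of local channels -/

/-- A single site at `p` with local Hilbert space `ℂ ^ n`. -/
def singleSite (p : M) (n : ℕ) : SiteSystem M where
  Site := Unit
  pos _ := p
  dim _ := n

/-- Basis labels of a single site. -/
def singleSiteConfig (p : M) (n : ℕ) : (singleSite p n).Config ≃ Fin n where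
  toFun η := η ()
  invFun k _ := k
  left_inv _ := rfl
  right_inv _ := rfl

section Dilation

variable {R : Type*} [Ring R] [StarRing R] {m : ℕ}

/-- The block matrix `((0, W*), (W, 1 - W W*))`, where `W` is the column of the Kraus operators. -/
def dilation (K : Fin m → R) : Matrix (Fin (m + 1)) (Fin (m + 1)) R := Matrix.of fun a b =>
  Fin.cases (Fin.cases 0 (fun k => star (K k)) b)
    (fun j => Fin.cases (K j) (fun k => (if j = k then 1 else 0) - K j * star (K k)) b) a

@[simp] theorem dilation_zero_zero (K : Fin m → R) : dilation K 0 0 = 0 := rfl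

@[simp] theorem dilation_zero_succ (K : Fin m → R) (k : Fin m) :
    dilation K 0 k.succ = star (K k) := rfl

@[simp] theorem dilation_succ_zero (K : Fin m → R) (j : Fin m) : dilation K j.succ 0 = K j := rfl

@[simp] theorem dilation_succ_succ (K : Fin m → R) (j k : Fin m) :
    dilation K j.succ k.succ = (if j = k then 1 else 0) - K j * star (K k) := rfl

theorem star_dilation (K : Fin m → R) : star (dilation K) = dilation K := by
  ext a b
  rw [Matrix.star_apply]
  cases a using Fin.cases <;> cases b using Fin.cases <;> simp [apply_ite star, eq_comm]

/-- From `W* W = 1`, the block `1 - W W*` is a projection that annihilates `W`, so the cross terms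
cancel and `W W* + (1 - W W*) = 1`. Being also self-adjoint, the block matrix is an explicit unitary
with the Kraus operators in its first column. -/
theorem dilation_mul_self (K : Fin m → R) (hK : ∑ k, star (K k) * K k = 1) :
    dilation K * dilation K = 1 := by
  have h : ∀ x y : R, ∑ l, x * star (K l) * (K l * y) = x * y := fun x y => by
    calc ∑ l, x * star (K l) * (K l * y) = x * (∑ l, star (K l) * K l) * y := by
          simp only [Finset.mul_sum, Finset.sum_mul, mul_assoc]
      _ = x * y := by rw [hK, mul_one]
  have h' : ∀ y : R, ∑ l, star (K l) * (K l * y) = y := fun y => by simpa using h 1 y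
  have h'' : ∀ x : R, ∑ l, x * star (K l) * K l = x := fun x => by simpa using h x 1
  ext a b
  rw [Matrix.mul_apply, Fin.sum_univ_succ]
  cases a using Fin.cases with
  | zero =>
    cases b using Fin.cases with
    | zero => simp [hK]
    | succ k => simp [mul_sub, h', (Fin.succ_ne_zero k).symm]
  | succ j =>
    cases b using Fin.cases with
    | zero => simp [sub_mul, h'', Fin.succ_ne_zero j]
    | succ k =>
      simp [sub_mul, mul_sub, h, Matrix.one_apply]

end Dilation

namespace HasConeModel

-- Stinespring's construction: put one ancilla of dimension `m + 1` at `p`, apply the local unitary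
-- `dilation K`, and trace the ancilla out. The ancilla accounts for the extra point `p` in the
-- cones.
open Classical in
theorem localChannel {T : SiteSystem M} {c : T.Site → Set M} {ρ : T.Op} (h : HasConeModel c ρ)
    {X : Set T.Site} {Φ : T.Op → T.Op} (hΦ : IsLocalChannel X Φ) (p : M) :
    HasConeModel (fun i => if i ∈ X then insert p (⋃ j ∈ X, c j) else c i) (Φ ρ) := by
  obtain ⟨m, K, hK, hK1, hΦ⟩ := hΦ
  let A := singleSite p (m + 1)
  let e : A.Config ≃ Fin (m + 1) := singleSiteConfig p (m + 1)
  let α : A.Vec := fun η => if e η = 0 then 1 else 0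
  have hα : IsProductState α := by
    let v : Fin (m + 1) → ℂ := fun s => if s = 0 then 1 else 0
    refine ⟨fun _ => v, fun i => ?_, ?_⟩
    · change ∑ s : Fin (m + 1), ‖v s‖ ^ 2 = 1
      simp only [v]
      rw [Finset.sum_eq_single 0] <;> simp +contextual
    · funext η
      exact (Fintype.prod_unique fun i : Unit => v (η i)).symm
  let G : Matrix A.Config A.Config T.Op := (dilation K).submatrix e e
  have hG : star G = G := by
    refine Matrix.ext fun η ξ => ?_
    exact congr_fun (congr_fun (star_dilation K) (e η)) (e ξ)
  have hG2 : G * G = 1 := by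
    rw [Matrix.submatrix_mul_equiv, dilation_mul_self K hK1, Matrix.submatrix_one_equiv]
  have hU : ofBlocks G ∈ Matrix.unitaryGroup (T.append A).Config ℂ := by
    rw [Matrix.mem_unitaryGroup_iff, ← ofBlocks_star, hG, ← ofBlocks_mul, hG2, ofBlocks_one]
  have hS : SupportedOn (S := T.append A) (Sum.inl '' X ∪ Sum.inr '' Set.univ) (ofBlocks G) := by
    refine SupportedOn.ofBlocks (fun η ξ => ?_) (by simp) fun η ξ η' ξ' h1 _ _ => ?_
    · change SupportedOn X (dilation K (e η) (e ξ))
      cases e η using Fin.cases with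
      | zero =>
        cases e ξ using Fin.cases with
        | zero => exact SupportedOn.zero
        | succ k => exact (hK k).star
      | succ j =>
        cases e ξ using Fin.cases with
        | zero => exact hK j
        | succ k =>
          refine SupportedOn.sub ?_ ((hK j).mul (hK k).star)
          split_ifs
          · exact SupportedOn.one
          · exact SupportedOn.zero
    · rw [show η = η' from funext fun i => (h1 i trivial).1,
        show ξ = ξ' from funext fun i => (h1 i trivial).2]
  have hρ : partialTrace (ofBlocks G * tensorOp ρ (ketBra α) * (ofBlocks G)ᴴ) = Φ ρ := by
    rw [← Matrix.star_eq_conjTranspose, ← ofBlocks_star, partialTrace_eq, blocks_mul, blocks_mul,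
      blocks_ofBlocks, blocks_ofBlocks, hΦ, ← e.symm.sum_comp, Fin.sum_univ_succ]
    have hb : ∀ a b, blocks (tensorOp ρ (ketBra α)) (e.symm a) (e.symm b) =
        if a = 0 ∧ b = 0 then ρ else 0 := fun a b => by
      rw [blocks_tensorOp, ketBra, Matrix.vecMulVec_apply]
      by_cases ha : a = 0 <;> by_cases hb : b = 0 <;> simp [α, ha, hb]
    -- The ancilla starts in basis state `0`, so only the first column of `dilation K` enters; its
    -- top entry is zero and the others are the Kraus operators.
    have key : ∀ a, (G * blocks (tensorOp ρ (ketBra α)) * star G) (e.symm a) (e.symm a) =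
        dilation K a 0 * ρ * star (dilation K a 0) := fun a => by
      rw [Matrix.mul_apply, ← e.symm.sum_comp, Finset.sum_eq_single 0]
      · rw [Matrix.mul_apply, ← e.symm.sum_comp, Finset.sum_eq_single 0]
        · simp [hb, G, Matrix.star_apply]
        · intro b _ hb0
          rw [hb, if_neg fun h => hb0 h.1, mul_zero]
        · simp
      · intro b _ hb0
        rw [Matrix.mul_apply, ← e.symm.sum_comp, Finset.sum_eq_zero, zero_mul]
        intro a' _
        rw [hb, if_neg fun h => hb0 h.2, mul_zero]
      · simp
    simp only [key]
    simp [Matrix.star_eq_conjTranspose]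
  rw [← hρ]
  refine HasConeModel.of_partialTrace (A := A)
    (c := Sum.elim (fun i => if i ∈ X then insert p (⋃ j ∈ X, c j) else c i)
      fun _ => insert p (⋃ j ∈ X, c j)) ((h.tensor hα).unitary_conj hS hU ?_ ?_)
  · rintro (i | i) hi
    · exact (if_neg (mt inl_mem_union.2 hi)).ge
    · exact absurd (inr_mem_union.2 (Set.mem_univ i)) hi
  · have hj : ∀ j ∈ (Sum.inl '' X ∪ Sum.inr '' Set.univ : Set (T.Site ⊕ A.Site)),
        Sum.elim c (fun i => {A.pos i}) j ⊆ insert p (⋃ j ∈ X, c j) := by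
      rintro _ (⟨j, hj, rfl⟩ | ⟨j, -, rfl⟩)
      · exact (Set.subset_biUnion_of_mem (u := c) hj).trans (Set.subset_insert _ _)
      · rintro _ rfl
        exact Set.mem_insert _ _
    rintro (i | i) hi j hjX
    · exact (hj j hjX).trans (if_pos (inl_mem_union.1 hi)).ge
    · exact hj j hjX

theorem channelBlocks [Nonempty M] {T : SiteSystem M} {c : T.Site → Set M} {ρ : T.Op}
    (h : HasConeModel c ρ) (hc : ∀ i, T.pos i ∈ c i)
    (blocks : List (Set T.Site × (T.Op → T.Op)))
    (hdisj : blocks.Pairwise fun g h => Disjoint g.1 h.1)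
    (hloc : ∀ g ∈ blocks, IsLocalChannel g.1 g.2) :
    HasConeModel (fun i => c i ∪ ⋃ g ∈ blocks, ⋃ (_ : i ∈ g.1), ⋃ j ∈ g.1, c j)
      ((blocks.map Prod.snd).foldr (fun f g => f ∘ g) id ρ) := by
  classical
  induction blocks with
  | nil => exact h.mono fun i => Set.subset_union_left
  | cons b l ih =>
    rw [List.pairwise_cons] at hdisj
    -- With the ancilla at a site of the block, its position already lies in one of the merged
    -- cones. An empty block has no such site, hence the need for `Nonempty M`.
    obtain ⟨p, hp⟩ : ∃ p, ∀ i ∈ b.1, ∃ j ∈ b.1, p ∈ c j := by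
      obtain hb | ⟨j, hj⟩ := b.1.eq_empty_or_nonempty
      · exact ⟨Classical.arbitrary M, by simp [hb]⟩
      · exact ⟨T.pos j, fun i _ => ⟨j, hj, hc j⟩⟩
    have hl := ih hdisj.2 fun g hg => hloc g (List.mem_cons_of_mem _ hg)
    refine (hl.localChannel (hloc b List.mem_cons_self) p).mono fun i z hz => ?_
    have hmem : i ∈ b.1 → ∀ j ∈ b.1, z ∈ c j →
        z ∈ c i ∪ ⋃ g ∈ b :: l, ⋃ (_ : i ∈ g.1), ⋃ j ∈ g.1, c j := fun hi j hj hz => by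
      refine Or.inr ?_
      simp only [Set.mem_iUnion]
      exact ⟨b, List.mem_cons_self, hi, j, hj, hz⟩
    by_cases hi : i ∈ b.1
    · rw [if_pos hi] at hz
      obtain rfl | hz := hz
      · obtain ⟨j, hj, hz⟩ := hp i hi
        exact hmem hi j hj hz
      · simp only [Set.mem_iUnion] at hz
        obtain ⟨j, hj, hz | hz⟩ := hz
        · exact hmem hi j hj hz
        · simp only [Set.mem_iUnion] at hz
          obtain ⟨g, hg, hjg, -⟩ := hz
          -- Blocks of one layer are disjoint, so the others have not enlarged the cones of the
          -- sites in `b`; a layer therefore costs its range only once.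
          exact (Set.disjoint_left.1 (hdisj.1 g hg) hj hjg).elim
    · rw [if_neg hi] at hz
      refine hz.imp_right fun hz => ?_
      simp only [Set.mem_iUnion] at hz ⊢
      obtain ⟨g, hg, hz⟩ := hz
      exact ⟨g, List.mem_cons_of_mem _ hg, hz⟩

end HasConeModel

/-! ### Light-cone radii of layers, circuits and LED -/

section Locality

variable [PseudoMetricSpace M]

theorem HasConeModel.channelLayer [Nonempty M] {T : SiteSystem M} {R r : ℝ} {ρ : T.Op}
    (h : HasConeModel (fun i => Metric.closedBall (T.pos i) R) ρ) (hR : 0 ≤ R) (hr : 0 ≤ r)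
    {Φ : T.Op → T.Op} (hΦ : IsChannelLayer r Φ) :
    HasConeModel (fun i => Metric.closedBall (T.pos i) (R + r)) (Φ ρ) := by
  obtain ⟨blocks, hdisj, hloc, rfl⟩ := hΦ
  refine (h.channelBlocks (fun i => Metric.mem_closedBall_self hR) blocks hdisj
    fun g hg => (hloc g hg).2).mono fun i => ?_
  refine Set.union_subset (Metric.closedBall_subset_closedBall (by linarith)) ?_
  simp only [Set.iUnion_subset_iff]
  intro g hg hi j hj
  exact Metric.closedBall_subset_closedBall' (by
    rw [add_le_add_iff_left]; exact (hloc g hg).1 j hj i hi)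

theorem IsLocalProcedure.nonneg {T : SiteSystem M} {R : ℝ} {Φ : T.Op → T.Op}
    (hΦ : IsLocalProcedure R Φ) : 0 ≤ R := by
  induction hΦ with
  | nil => exact le_rfl
  | step hr _ _ ih => exact add_nonneg ih hr

theorem HasConeModel.localProcedure [Nonempty M] {T : SiteSystem M} {R₀ R : ℝ} {ρ : T.Op}
    (h : HasConeModel (fun i => Metric.closedBall (T.pos i) R₀) ρ) (hR₀ : 0 ≤ R₀)
    {Φ : T.Op → T.Op} (hΦ : IsLocalProcedure R Φ) :
    HasConeModel (fun i => Metric.closedBall (T.pos i) (R₀ + R)) (Φ ρ) := by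
  induction hΦ with
  | nil => simpa using h
  | step hr hΨ hΦ ih =>
    rw [← add_assoc]
    exact ih.channelLayer (add_nonneg hR₀ hΦ.nonneg) hr hΨ

theorem IsUnitaryLayer.isChannelLayer {T : SiteSystem M} {r : ℝ} {V : T.Op}
    (hV : IsUnitaryLayer r V) : IsChannelLayer r fun ρ : T.Op => V * ρ * Vᴴ := by
  obtain ⟨gates, hdisj, hloc, rfl⟩ := hV
  refine ⟨gates.map fun g => (g.1, fun ρ => g.2 * ρ * g.2ᴴ), ?_, ?_, ?_⟩
  · exact List.pairwise_map.2 hdisj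
  · intro g hg
    obtain ⟨g', hg', rfl⟩ := List.mem_map.1 hg
    obtain ⟨h1, h2, h3⟩ := hloc g' hg'
    refine ⟨h1, 1, fun _ => g'.2, fun _ => h2, ?_, fun ρ => by simp⟩
    simpa [Matrix.star_eq_conjTranspose] using Matrix.mem_unitaryGroup_iff'.1 h3
  · clear hdisj hloc
    induction gates with
    | nil => funext ρ; simp
    | cons g l ih =>
      simp only [List.map_cons, List.prod_cons, List.foldr_cons, ← ih]
      funext ρ
      simp [Matrix.conjTranspose_mul, mul_assoc]

/-- A unitary gate is a channel with one Kraus operator, so the same propagation bound serves the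
preparation circuit and LED. -/
theorem IsCircuit.isLocalProcedure {T : SiteSystem M} {r : ℝ} (hr : 0 ≤ r) {D : ℕ} {U : T.Op}
    (hU : IsCircuit r D U) : IsLocalProcedure (D * r) fun ρ : T.Op => U * ρ * Uᴴ := by
  induction hU with
  | nil =>
    convert IsLocalProcedure.nil (S := T) using 1
    · simp
    · funext ρ; simp
  | step hV _ ih =>
    convert IsLocalProcedure.step hr hV.isChannelLayer ih using 1
    · push_cast; ring
    · funext ρ
      simp [Matrix.conjTranspose_mul, mul_assoc]

/-- The output of a local procedure on a state with a purification of small depth has small dependency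
cones. -/
theorem HasPurificationOfDepth.hasConeModel [Nonempty M] {S : SiteSystem M} {ρ : S.Op} {r : ℝ}
    (hr : 0 ≤ r) {D : ℕ} (hρ : HasPurificationOfDepth ρ r D) {κ d : ℝ} (P : LED S κ d) :
    HasConeModel (fun i => Metric.closedBall ((S.append P.anc).pos i) (D * r + P.range))
      (P.output ρ) := by
  obtain ⟨E, ψ₀, U, hψ₀, hU, rfl⟩ := hρ
  have h0 : HasConeModel (fun i => Metric.closedBall ((S.append E).pos i) 0) (ketBra ψ₀) :=
    (HasConeModel.of_product hψ₀).mono fun i =>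
      Set.singleton_subset_iff.2 (Metric.mem_closedBall_self le_rfl)
  have h1 := h0.localProcedure le_rfl (hU.isLocalProcedure hr)
  have hDr : 0 ≤ D * r := by positivity
  have h2 : U * ketBra ψ₀ * Uᴴ = ketBra (U *ᵥ ψ₀) := by
    rw [ketBra, ketBra, Matrix.mul_vecMulVec, Matrix.vecMulVec_mul, Matrix.star_mulVec]
  rw [h2, zero_add] at h1
  have h3 := h1.of_partialTrace.tensor P.ancState_product
  refine HasConeModel.localProcedure (h3.mono ?_) hDr P.isLocal
  rintro (i | i)
  · exact subset_rfl
  · exact Set.singleton_subset_iff.2 (Metric.mem_closedBall_self hDr)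

end Locality

/-! ### Product operators and the projectors onto a product state -/

section ProductOperators

variable {F : SiteSystem M}

/-- The product operator `⨂ i, A i`. -/
def productOp (A : ∀ i : F.Site, Matrix (Fin (F.dim i)) (Fin (F.dim i)) ℂ) : F.Op :=
  fun σ τ => ∏ i, A i (σ i) (τ i)

theorem productOp_mul (A B : ∀ i : F.Site, Matrix (Fin (F.dim i)) (Fin (F.dim i)) ℂ) :
    productOp A * productOp B = productOp fun i => A i * B i := by
  ext σ τ
  simp only [productOp, Matrix.mul_apply, Finset.prod_univ_sum, Fintype.piFinset_univ,
    Finset.prod_mul_distrib]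

theorem productOp_star (A : ∀ i : F.Site, Matrix (Fin (F.dim i)) (Fin (F.dim i)) ℂ) :
    star (productOp A) = productOp fun i => star (A i) := by
  ext σ τ
  simp [productOp, Matrix.star_apply]

theorem productOp_mulVec (A : ∀ i : F.Site, Matrix (Fin (F.dim i)) (Fin (F.dim i)) ℂ)
    (φ : ∀ i : F.Site, Fin (F.dim i) → ℂ) :
    productOp A *ᵥ productVec φ = productVec fun i => A i *ᵥ φ i := by
  funext σ
  simp only [productOp, productVec, Matrix.mulVec, dotProduct, Finset.prod_univ_sum,
    Fintype.piFinset_univ, Finset.prod_mul_distrib]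

theorem SupportedOn.productOp {X : Set F.Site}
    {A : ∀ i : F.Site, Matrix (Fin (F.dim i)) (Fin (F.dim i)) ℂ} (hA : ∀ i ∉ X, A i = 1) :
    SupportedOn X (productOp A) := by
  refine ⟨fun σ τ ⟨i, hi, hne⟩ => ?_, fun σ τ σ' τ' h1 h2 h3 => ?_⟩
  · exact Finset.prod_eq_zero (Finset.mem_univ i) (by rw [hA i hi, Matrix.one_apply_ne hne])
  · refine Finset.prod_congr rfl fun i _ => ?_
    by_cases hi : i ∈ X
    · rw [(h1 i hi).1, (h1 i hi).2]
    · rw [hA i hi, h2 i hi, h3 i hi, Matrix.one_apply_eq, Matrix.one_apply_eq]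

open Classical in
/-- The projector onto the product vector `⨂ i ∈ X, φ i`, tensored with the identity. -/
def productProj (φ : ∀ i : F.Site, Fin (F.dim i) → ℂ) (X : Set F.Site) : F.Op :=
  productOp fun i => if i ∈ X then Matrix.vecMulVec (φ i) (star (φ i)) else 1

variable {φ : ∀ i : F.Site, Fin (F.dim i) → ℂ}

theorem supportedOn_productProj (X : Set F.Site) : SupportedOn X (productProj φ X) :=
  SupportedOn.productOp fun i hi => by simp [hi]

theorem star_productProj (X : Set F.Site) : star (productProj φ X) = productProj φ X := by
  rw [productProj, productOp_star]
  congr 1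
  funext i
  split_ifs
  · rw [Matrix.star_eq_conjTranspose, Matrix.conjTranspose_vecMulVec, star_star]
  · exact star_one _

theorem star_dotProduct_self_of_norm {n : ℕ} {v : Fin n → ℂ} (hv : ∑ s, ‖v s‖ ^ 2 = 1) :
    star v ⬝ᵥ v = 1 := by
  have : star v ⬝ᵥ v = ((∑ s, ‖v s‖ ^ 2 : ℝ) : ℂ) := by
    push_cast
    exact Finset.sum_congr rfl fun s _ => Complex.conj_mul' (v s)
  rw [this, hv, Complex.ofReal_one]

theorem productProj_mul (hφ : ∀ i, ∑ s, ‖φ i s‖ ^ 2 = 1) (X Y : Set F.Site) :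
    productProj φ X * productProj φ Y = productProj φ (X ∪ Y) := by
  rw [productProj, productProj, productOp_mul]
  refine congrArg productOp (funext fun i => ?_)
  by_cases hX : i ∈ X <;> by_cases hY : i ∈ Y <;>
    simp [hX, hY, Matrix.vecMulVec_mul_vecMulVec, star_dotProduct_self_of_norm (hφ i)]

theorem productProj_mulVec (hφ : ∀ i, ∑ s, ‖φ i s‖ ^ 2 = 1) (X : Set F.Site) :
    productProj φ X *ᵥ productVec φ = productVec φ := by
  rw [productProj, productOp_mulVec]
  refine congrArg productVec (funext fun i => ?_)
  split_ifs
  · rw [Matrix.vecMulVec_mulVec, star_dotProduct_self_of_norm (hφ i)]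
    simp
  · rw [Matrix.one_mulVec]

theorem productProj_univ : productProj φ Set.univ = ketBra (productVec φ) := by
  ext σ τ
  simp [productProj, productOp, ketBra, productVec, Matrix.vecMulVec_apply,
    Finset.prod_mul_distrib]

theorem star_productVec_dotProduct_self (hφ : ∀ i, ∑ s, ‖φ i s‖ ^ 2 = 1) :
    star (productVec φ) ⬝ᵥ productVec φ = 1 := by
  have h : star (productVec φ) ⬝ᵥ productVec φ = ∏ i, (star (φ i) ⬝ᵥ φ i) := by
    simp only [productVec, dotProduct, Finset.prod_univ_sum, Fintype.piFinset_univ,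
      Finset.prod_mul_distrib, Pi.star_apply, star_prod]
  rw [h, Finset.prod_eq_one fun i _ => star_dotProduct_self_of_norm (hφ i)]

/-- The expectation value of `O` in the pure state `Ω`. -/
def expect (Ω : F.Vec) (O : F.Op) : ℂ := star Ω ⬝ᵥ (O *ᵥ Ω)

/-- Compression of an operator on `X` by the projector onto the product state on `X`. -/
theorem productProj_mul_mul (hφ : ∀ i, ∑ s, ‖φ i s‖ ^ 2 = 1) {X : Set F.Site} {L : F.Op}
    (hL : SupportedOn X L) :
    productProj φ X * L * productProj φ X = expect (productVec φ) L • productProj φ X := by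
  set Ω := productVec φ
  set p := productProj φ X
  set q := productProj φ Xᶜ
  have hp : SupportedOn X p := supportedOn_productProj X
  have hq : SupportedOn Xᶜ q := supportedOn_productProj Xᶜ
  have hqp : q * p = ketBra Ω := by rw [productProj_mul hφ, Set.compl_union_self, productProj_univ]
  have hpq : p * q = ketBra Ω := by rw [productProj_mul hφ, Set.union_compl_self, productProj_univ]
  have hqq : q * q = q := by rw [productProj_mul hφ, Set.union_self]
  have hLq : L * q = q * L := (SupportedOn.commute disjoint_compl_right hL hq).eq
  have hkey : ketBra Ω * L * ketBra Ω = expect Ω L • ketBra Ω := by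
    rw [ketBra, Matrix.vecMulVec_mul, Matrix.vecMulVec_mul_vecMulVec, expect,
      Matrix.dotProduct_mulVec, Matrix.vecMulVec_smul]
  have hq0 : q ≠ 0 := fun h0 => by
    have h1 : q *ᵥ Ω = Ω := productProj_mulVec hφ _
    have h2 : star Ω ⬝ᵥ Ω = 1 := star_productVec_dotProduct_self hφ
    rw [← h1, h0] at h2
    simp at h2
  rw [← sub_eq_zero]
  -- Tensoring with `q` turns `p` into the rank-one projector onto `Ω`, for which the identity is
  -- `hkey`. The nonzero factor `q` on the complement can then be cancelled.
  refine SupportedOn.eq_zero_of_mul_eq_zero hq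
    (by rw [compl_compl]; exact ((hp.mul hL).mul hp).sub (hp.smul _)) ?_ hq0
  rw [mul_sub, sub_eq_zero, mul_smul_comm, hqp, ← hkey]
  calc q * (p * L * p) = q * q * p * L * p := by rw [hqq]; simp only [mul_assoc]
    _ = q * p * q * L * p := by rw [mul_assoc q q p, mul_assoc q p q, hqp, hpq]
    _ = q * p * L * (q * p) := by rw [mul_assoc _ q L, ← hLq]; simp only [mul_assoc]
    _ = ketBra Ω * L * ketBra Ω := by rw [hqp]

end ProductOperators

/-! ### Expectation values -/

section Expectation

variable {F : SiteSystem M} (Ω : F.Vec)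

theorem expect_add (O O' : F.Op) : expect Ω (O + O') = expect Ω O + expect Ω O' := by
  simp [expect, Matrix.add_mulVec]

theorem expect_sub (O O' : F.Op) : expect Ω (O - O') = expect Ω O - expect Ω O' := by
  simp [expect, Matrix.sub_mulVec]

theorem expect_neg (O : F.Op) : expect Ω (-O) = -expect Ω O := by
  simp [expect, Matrix.neg_mulVec]

theorem expect_smul (a : ℂ) (O : F.Op) : expect Ω (a • O) = a * expect Ω O := by
  simp [expect, Matrix.smul_mulVec]

theorem expect_star (O : F.Op) : expect Ω (star O) = star (expect Ω O) := by
  rw [expect, expect, ← Matrix.star_dotProduct, Matrix.star_mulVec, ← Matrix.dotProduct_mulVec,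
    Matrix.star_eq_conjTranspose]

theorem expect_star_mul_self_nonneg (O : F.Op) : 0 ≤ (expect Ω (star O * O)).re := by
  have h : expect Ω (star O * O) = star (O *ᵥ Ω) ⬝ᵥ (O *ᵥ Ω) := by
    rw [expect, ← Matrix.mulVec_mulVec, Matrix.dotProduct_mulVec, Matrix.star_mulVec,
      Matrix.star_eq_conjTranspose]
  rw [h]
  exact (Complex.le_def.1 (dotProduct_star_self_nonneg (O *ᵥ Ω))).1

theorem expect_mul_of_mulVec {P : F.Op} (hP : P *ᵥ Ω = Ω) (O : F.Op) :
    expect Ω (O * P) = expect Ω O := by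
  rw [expect, ← Matrix.mulVec_mulVec, hP, expect]

theorem expect_mul_of_mulVec' {P : F.Op} (hP : P *ᵥ Ω = Ω) (hP' : star P = P) (O : F.Op) :
    expect Ω (P * O) = expect Ω O := by
  have h := congrArg star (expect_mul_of_mulVec Ω hP (star O))
  rwa [← expect_star, ← expect_star, star_mul, star_star, hP'] at h

theorem one_sub_mul_self_of_sq_eq_one {A : F.Op} (hA : A * A = 1) :
    (1 - A) * (1 - A) = (2 : ℂ) • (1 - A) := by
  have : (1 - A) * (1 - A) = 1 - A - A + A * A := by noncomm_ring
  rw [this, hA, two_smul]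
  abel

/-- A reflection satisfies `L ≤ 1`, because `1 - L` is half of its own square. -/
theorem expect_conj_le {L : F.Op} (hL : star L = L) (hL2 : L * L = 1) (O : F.Op) :
    (expect Ω (star O * L * O)).re ≤ (expect Ω (star O * O)).re := by
  have h := expect_star_mul_self_nonneg Ω ((1 - L) * O)
  have e : star ((1 - L) * O) * ((1 - L) * O) = (2 : ℂ) • (star O * O - star O * L * O) := by
    rw [star_mul, star_sub, star_one, hL, mul_assoc, ← mul_assoc (1 - L),
      one_sub_mul_self_of_sq_eq_one hL2]
    simp [sub_mul, mul_sub, mul_assoc]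
  rw [e, expect_smul, expect_sub] at h
  simp at h
  linarith

/-- The union bound for commuting reflections. -/
theorem expect_mul_of_commute {A B : F.Op} (hA : star A = A) (hB : star B = B)
    (hA2 : A * A = 1) (hB2 : B * B = 1) (hAB : A * B = B * A) :
    (expect Ω A).re + (expect Ω B).re - (expect Ω 1).re ≤ (expect Ω (A * B)).re := by
  -- Up to a factor 4, `(1 - A) * (1 - B)` is a product of commuting projections, hence itself
  -- positive.
  have h := expect_star_mul_self_nonneg Ω ((1 - A) * (1 - B))
  have e : star ((1 - A) * (1 - B)) * ((1 - A) * (1 - B)) = (4 : ℂ) • (1 - A - B + A * B) := by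
    have h1 := one_sub_mul_self_of_sq_eq_one hA2
    have h2 := one_sub_mul_self_of_sq_eq_one hB2
    have h3 : (1 - A) * (1 - B) = (1 - B) * (1 - A) := by
      simp only [sub_mul, mul_sub, hAB, one_mul, mul_one]; abel
    rw [star_mul, star_sub, star_sub, star_one, hA, hB]
    calc (1 - B) * (1 - A) * ((1 - A) * (1 - B))
        = (1 - B) * ((1 - A) * (1 - A)) * (1 - B) := by simp only [mul_assoc]
      _ = (2 : ℂ) • ((1 - B) * (1 - A) * (1 - B)) := by rw [h1]; simp
      _ = (2 : ℂ) • ((1 - A) * ((1 - B) * (1 - B))) := by rw [← h3, mul_assoc]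
      _ = (4 : ℂ) • ((1 - A) * (1 - B)) := by rw [h2, mul_smul_comm, smul_smul]; norm_num
      _ = _ := by congr 1; simp only [sub_mul, mul_sub, one_mul, mul_one]; abel
  rw [e, expect_smul, expect_add, expect_sub, expect_sub] at h
  simp at h
  linarith

end Expectation

/-- In a product state, an operator `P` that is the part of an approximate symmetry `R * P` cannot
anticommute with an approximate symmetry `L` that avoids the overlap of `P` and `R`. -/
theorem IsProductState.false_of_anticommute {F : SiteSystem M} {Ω : F.Vec} (hΩ : IsProductState Ω)
    {A B C : Set F.Site} {P R L : F.Op} (hP : SupportedOn A P) (hR : SupportedOn B R)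
    (hL : SupportedOn C L) (hABC : ∀ i, i ∈ A → i ∈ B → i ∉ C)
    (hP1 : star P * P = 1) (hR1 : star R * R = 1) (hL1 : star L = L) (hL2 : L * L = 1)
    (hPL : P * L = -(L * P)) (hRP : 7 / 8 ≤ (expect Ω (R * P)).re)
    (hLΩ : 7 / 8 ≤ (expect Ω L).re) : False := by
  obtain ⟨φ, hφ, rfl⟩ := hΩ
  set Ω := productVec φ
  set p := productProj φ (A ∩ B)ᶜ with hp
  set p₁ := productProj φ (A \ B) with hp₁
  set p₂ := productProj φ Aᶜ with hp₂
  have hpp : p = p₁ * p₂ := by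
    rw [hp₁, hp₂, productProj_mul hφ, hp]
    congr 1
    ext i
    simp only [Set.mem_compl_iff, Set.mem_inter_iff, Set.mem_union, Set.mem_sdiff]
    tauto
  have hps : star p = p := star_productProj _
  have hp2 : p * p = p := by rw [hp, productProj_mul hφ, Set.union_self]
  have hp₁s : star p₁ = p₁ := star_productProj _
  have hp₁2 : p₁ * p₁ = p₁ := by rw [hp₁, productProj_mul hφ, Set.union_self]
  have hpL : p * L * p = expect Ω L • p :=
    productProj_mul_mul hφ (hL.mono fun i hC h => hABC i h.1 h.2 hC)
  have hp₁Ω : p₁ *ᵥ Ω = Ω := productProj_mulVec hφ _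
  have hp₂Ω : p₂ *ᵥ Ω = Ω := productProj_mulVec hφ _
  have hp₂P : p₂ * P = P * p₂ :=
    (SupportedOn.commute disjoint_compl_left (supportedOn_productProj _) hP).eq
  have hp₁R : p₁ * R = R * p₁ :=
    (SupportedOn.commute Set.disjoint_sdiff_left (supportedOn_productProj _) hR).eq
  have hone : expect Ω 1 = 1 := by
    rw [expect, Matrix.one_mulVec, star_productVec_dotProduct_self hφ]
  -- the string operator `P` creates excitations only where `P` and `R` overlap
  set y := (expect Ω (star P * p * P)).re with hy
  have hy1 : 3 / 4 ≤ y := by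
    -- Of the two factors of `p`, `p₂` passes through `P` and is absorbed by `Ω`, while `p₁`
    -- commutes with `R`, so that `star R * R = 1` may be inserted.
    have e1 : expect Ω (star P * p * P) = expect Ω (star (R * P) * p₁ * (R * P)) := by
      rw [hpp, mul_assoc, mul_assoc p₁, hp₂P, ← mul_assoc, ← mul_assoc, expect_mul_of_mulVec _ hp₂Ω,
        star_mul]
      have : star P * star R * p₁ * (R * P) = star P * (star R * R) * p₁ * P := by
        simp only [mul_assoc]
        rw [← mul_assoc p₁ R, hp₁R, mul_assoc]
      rw [this, hR1, mul_one]
    -- The squared norm of `p₁ (R P - 1) Ω` is `y - 2 Re ⟨R P⟩ + 1`; its positivity gives `y ≥ 2 *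
    -- (7 / 8) - 1`.
    have e2 := expect_star_mul_self_nonneg Ω (p₁ * (R * P - 1))
    have e3 : star (p₁ * (R * P - 1)) * (p₁ * (R * P - 1)) =
        star (R * P) * p₁ * (R * P) - star (R * P) * p₁ - p₁ * (R * P) + p₁ := by
      rw [star_mul, hp₁s, mul_assoc, ← mul_assoc p₁ p₁, hp₁2, star_sub, star_one]
      simp only [sub_mul, mul_sub, one_mul, mul_one, mul_assoc]
      abel
    have e4 : expect Ω p₁ = 1 := by
      rw [← one_mul p₁, expect_mul_of_mulVec _ hp₁Ω, hone]
    rw [e3, expect_add, expect_sub, expect_sub, ← e1, expect_mul_of_mulVec _ hp₁Ω,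
      expect_mul_of_mulVec' _ hp₁Ω hp₁s, expect_star, e4] at e2
    simp at e2
    linarith
  have hPp : (expect Ω (star P * (1 - p) * P)).re = 1 - y := by
    rw [mul_sub, sub_mul, mul_one, hP1, expect_sub, hone, hy, Complex.sub_re, Complex.one_re]
  have hPL' : star P * L * P = -L := by
    rw [mul_assoc, ← neg_eq_iff_eq_neg.2 hPL, mul_neg, ← mul_assoc, hP1, one_mul]
  -- Split `P Ω` into `u = p P Ω` and `v = (1 - p) P Ω`. The parallelogram identity `e3` for the
  -- form of `L` at `u + v` and `u - v` removes the cross terms, so only bounds at `u - v` and at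
  -- `v` are required.
  have h1 := expect_conj_le Ω hL1 hL2 (p * P - (1 - p) * P)
  have h2 := expect_conj_le Ω (L := -L) (by rw [star_neg, hL1]) (by rw [neg_mul_neg, hL2]) ((1 - p) * P)
  have e1 : star (p * P - (1 - p) * P) * (p * P - (1 - p) * P) = 1 := by
    simp only [star_sub, star_mul, star_one, hps]
    calc _ = star P * (1 - 4 • p + 4 • (p * p)) * P := by noncomm_ring
      _ = 1 := by rw [hp2, sub_add_cancel, mul_one, hP1]
  have e2 : star ((1 - p) * P) * ((1 - p) * P) = star P * (1 - p) * P := by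
    simp only [star_sub, star_mul, star_one, hps]
    calc _ = star P * (1 - p - p + p * p) * P := by noncomm_ring
      _ = _ := by rw [hp2, sub_add_cancel]
  have e3 : star P * L * P + star (p * P - (1 - p) * P) * L * (p * P - (1 - p) * P) =
      (star P * (p * L * p) * P + star P * (p * L * p) * P) +
      (star ((1 - p) * P) * L * ((1 - p) * P) + star ((1 - p) * P) * L * ((1 - p) * P)) := by
    simp only [star_sub, star_mul, star_one, hps]
    noncomm_ring
  have e4 := congrArg (fun O => (expect Ω O).re) e3
  have hLreal : (expect Ω L).im = 0 := by
    have := expect_star Ω L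
    rw [hL1] at this
    exact Complex.conj_eq_iff_im.1 this.symm
  simp only [expect_add, hpL, hPL', expect_neg, mul_smul_comm, smul_mul_assoc, expect_smul,
    Complex.add_re, Complex.neg_re, Complex.mul_re, hLreal, zero_mul, sub_zero, ← hy] at e4
  rw [e1, hone] at h1
  rw [e2, hPp, mul_neg, neg_mul, expect_neg, Complex.neg_re] at h2
  simp only [Complex.one_re] at h1
  -- With `ℓ = ⟨L⟩`, the estimates combine to `1 - ℓ ≥ 2 ℓ y - 2 (1 - y)`, which fails for `ℓ ≥ 7 /
  -- 8` and `y ≥ 3 / 4`.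
  nlinarith [mul_nonneg (sub_nonneg.2 hLΩ) (sub_nonneg.2 hy1)]

/-! ### Pauli operators -/

section Pauli

variable {S : SiteSystem M} {Y Z : Set S.Site}

open Classical in
/-- The basis label with the spins in `Y` flipped. -/
def flip (Y : Set S.Site) (σ : S.Config) : S.Config := fun i => if i ∈ Y then (σ i).rev else σ i

theorem ne_iff_eq_rev_of_eq_two {n : ℕ} (hn : n = 2) (s t : Fin n) : s ≠ t ↔ t = s.rev := by
  subst hn
  revert s t
  decide

theorem eq_flip_iff (hY : ∀ i ∈ Y, S.dim i = 2) (σ τ : S.Config) :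
    τ = flip Y σ ↔ (∀ i ∈ Y, σ i ≠ τ i) ∧ ∀ i, i ∉ Y → σ i = τ i := by
  refine ⟨?_, fun ⟨h1, h2⟩ => funext fun i => ?_⟩
  · rintro rfl
    refine ⟨fun i hi => ?_, fun i hi => by simp [flip, hi]⟩
    rw [ne_iff_eq_rev_of_eq_two (hY i hi), flip, if_pos hi]
  · by_cases hi : i ∈ Y
    · rw [flip, if_pos hi, ← ne_iff_eq_rev_of_eq_two (hY i hi)]
      exact h1 i hi
    · rw [flip, if_neg hi, h2 i hi]

open Classical in
theorem pauliX_apply (hY : ∀ i ∈ Y, S.dim i = 2) (σ τ : S.Config) :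
    pauliX Y σ τ = if τ = flip Y σ then 1 else 0 := by
  simp only [pauliX, eq_flip_iff hY]

theorem pauliX_empty : pauliX (∅ : Set S.Site) = 1 := by
  ext σ τ
  simp [pauliX, Matrix.one_apply, funext_iff]

theorem pauliX_symmDiff (hY : ∀ i ∈ Y, S.dim i = 2) (hZ : ∀ i ∈ Z, S.dim i = 2) :
    pauliX (symmDiff Y Z) = pauliX Y * pauliX Z := by
  classical
  have hYZ : ∀ i ∈ symmDiff Y Z, S.dim i = 2 := fun i hi =>
    hi.elim (fun h => hY i h.1) fun h => hZ i h.1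
  ext σ τ
  rw [Matrix.mul_apply, Finset.sum_eq_single (flip Y σ)]
  · have : flip (symmDiff Y Z) σ = flip Z (flip Y σ) := by
      funext i
      by_cases h1 : i ∈ Y <;> by_cases h2 : i ∈ Z <;> simp [flip, Set.mem_symmDiff, h1, h2]
    rw [pauliX_apply hYZ, pauliX_apply hY, pauliX_apply hZ, if_pos rfl, one_mul, this]
  · intro μ _ hμ
    rw [pauliX_apply hY, if_neg hμ, zero_mul]
  · simp

theorem star_pauliX : star (pauliX Y) = pauliX Y := by
  classical
  ext σ τ
  have h : ((∀ i ∈ Y, τ i ≠ σ i) ∧ ∀ i, i ∉ Y → τ i = σ i) ↔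
      (∀ i ∈ Y, σ i ≠ τ i) ∧ ∀ i, i ∉ Y → σ i = τ i :=
    and_congr (forall₂_congr fun _ _ => ne_comm) (forall₂_congr fun _ _ => eq_comm)
  simp only [Matrix.star_apply, pauliX, apply_ite star, star_one, star_zero]
  exact if_congr h rfl rfl

theorem supportedOn_pauliX : SupportedOn Y (pauliX Y) := by
  classical
  refine ⟨fun σ τ ⟨i, hi, h⟩ => if_neg fun h' => h (h'.2 i hi), fun σ τ σ' τ' h1 h2 h3 => ?_⟩
  have : (∀ i ∈ Y, σ i ≠ τ i) ↔ ∀ i ∈ Y, σ' i ≠ τ' i :=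
    forall₂_congr fun i hi => by rw [(h1 i hi).1, (h1 i hi).2]
  have h4 : (∀ i, i ∉ Y → σ i = τ i) ↔ ∀ i, i ∉ Y → σ' i = τ' i := ⟨fun _ => h3, fun _ => h2⟩
  exact if_congr (and_congr this h4) rfl rfl

open Classical in
theorem neg_one_pow_ite_mul (n : ℕ) (p q : Prop) :
    (if p then (-1 : ℂ) ^ n else 1) * (if q then (-1 : ℂ) ^ n else 1) =
      if Xor p q then (-1 : ℂ) ^ n else 1 := by
  by_cases hp : p <;> by_cases hq : q <;> simp [hp, hq, Xor, ← pow_add, ← two_mul, pow_mul]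

theorem pauliZ_empty : pauliZ (∅ : Set S.Site) = 1 := by
  simp [pauliZ]

theorem pauliZ_symmDiff : pauliZ (symmDiff Y Z) = pauliZ Y * pauliZ Z := by
  classical
  rw [pauliZ, pauliZ, pauliZ, Matrix.diagonal_mul_diagonal]
  congr 1
  funext σ
  rw [← Finset.prod_mul_distrib]
  refine Finset.prod_congr rfl fun i _ => ?_
  rw [neg_one_pow_ite_mul]
  exact if_congr Iff.rfl rfl rfl

theorem star_pauliZ : star (pauliZ Y) = pauliZ Y := by
  rw [pauliZ, Matrix.star_eq_conjTranspose, Matrix.diagonal_conjTranspose]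
  congr 1
  funext σ
  simp [Pi.star_apply, star_prod, apply_ite star]

theorem supportedOn_pauliZ : SupportedOn Y (pauliZ Y) := by
  refine ⟨fun σ τ ⟨i, hi, h⟩ => Matrix.diagonal_apply_ne _ fun h' => h (by rw [h']),
    fun σ τ σ' τ' h1 h2 h3 => ?_⟩
  by_cases h : σ = τ
  · subst h
    have h' : σ' = τ' := funext fun i => by
      by_cases hi : i ∈ Y
      · rw [← (h1 i hi).1, ← (h1 i hi).2]
      · exact h3 i hi
    subst h'
    rw [pauliZ, Matrix.diagonal_apply_eq, Matrix.diagonal_apply_eq]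
    refine Finset.prod_congr rfl fun i _ => ?_
    by_cases hi : i ∈ Y
    · simp [hi, (h1 i hi).1]
    · simp [hi]
  · have h' : σ' ≠ τ' := by
      rintro rfl
      refine h (funext fun i => ?_)
      by_cases hi : i ∈ Y
      · rw [(h1 i hi).1, (h1 i hi).2]
      · exact h2 i hi
    rw [pauliZ, Matrix.diagonal_apply_ne _ h, Matrix.diagonal_apply_ne _ h']

/-- Flipping the one common qubit changes the sign of exactly one factor in the diagonal of `pauliZ
Z`. -/
theorem pauliX_mul_pauliZ (hY : ∀ i ∈ Y, S.dim i = 2) {e : S.Site} (he : Y ∩ Z = {e}) :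
    pauliX Y * pauliZ Z = -(pauliZ Z * pauliX Y) := by
  classical
  have heY : e ∈ Y ∩ Z := by rw [he]; rfl
  ext σ τ
  rw [Matrix.neg_apply, pauliZ, Matrix.mul_diagonal, Matrix.diagonal_mul]
  by_cases h : (∀ i ∈ Y, σ i ≠ τ i) ∧ ∀ i, i ∉ Y → σ i = τ i
  · rw [pauliX, if_pos h, one_mul, mul_one, ← Finset.mul_prod_erase _ _ (Finset.mem_univ e),
      ← Finset.mul_prod_erase _ _ (Finset.mem_univ e), if_pos heY.2, if_pos heY.2, ← neg_mul]
    congr 1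
    · have key : ∀ (n : ℕ) (_ : n = 2) (s t : Fin n), s ≠ t →
          (-1 : ℂ) ^ (t : ℕ) = -(-1 : ℂ) ^ (s : ℕ) := by
        rintro n rfl s t hst
        fin_cases s <;> fin_cases t <;> simp at hst ⊢
      exact key _ (hY e heY.1) _ _ (h.1 e heY.1)
    · refine Finset.prod_congr rfl fun i hi => ?_
      by_cases hiZ : i ∈ Z
      · have hiY : i ∉ Y := fun hiY => Finset.ne_of_mem_erase hi
          (by have : i ∈ Y ∩ Z := ⟨hiY, hiZ⟩
              rwa [he] at this)
        rw [h.2 i hiY]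
      · simp [hiZ]
  · rw [pauliX, if_neg h]
    simp

end Pauli

/-! ### Products of stabilizers -/

section OddSet

variable {ι J : Type*}

open Classical in
/-- The elements that lie in an odd number of the sets `s j`, `j ∈ W`. -/
def oddSet (s : J → Set ι) (W : Finset J) : Set ι := {i | Odd (W.filter fun j => i ∈ s j).card}

theorem oddSet_empty (s : J → Set ι) : oddSet s ∅ = ∅ := by
  ext i; simp [oddSet]

theorem oddSet_insert [DecidableEq J] (s : J → Set ι) {W : Finset J} {j : J} (hj : j ∉ W) :
    oddSet s (insert j W) = symmDiff (s j) (oddSet s W) := by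
  classical
  ext i
  simp only [oddSet, Set.mem_symmDiff, Set.mem_ofPred_eq, Finset.filter_insert]
  by_cases hi : i ∈ s j
  · rw [if_pos hi, Finset.card_insert_of_notMem (by simp [hj]), Nat.odd_add_one]
    simp [hi]
  · simp [hi]

theorem exists_mem_of_mem_oddSet {s : J → Set ι} {W : Finset J} {i : ι} (hi : i ∈ oddSet s W) :
    ∃ j ∈ W, i ∈ s j := by
  classical
  obtain ⟨j, hj⟩ := Finset.card_pos.1 (Odd.pos hi)
  exact ⟨j, (Finset.mem_filter.1 hj).1, (Finset.mem_filter.1 hj).2⟩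

/-- A link has two endpoints, and an interior link borders two plaquettes. Membership in a product
of stabilizers thus means that exactly one of the two lies in the box, which makes the product a
boundary loop. -/
theorem mem_oddSet_iff_xor {s : J → Set ι} {W : Finset J} {i : ι} {u w : J} (huw : u ≠ w)
    (h : ∀ j, i ∈ s j ↔ j = u ∨ j = w) : i ∈ oddSet s W ↔ Xor (u ∈ W) (w ∈ W) := by
  classical
  have : (W.filter fun j => i ∈ s j) = ({u, w} : Finset J).filter (· ∈ W) := by
    ext j
    simp only [Finset.mem_filter, h, Finset.mem_insert, Finset.mem_singleton]
    tauto
  simp only [oddSet, Set.mem_ofPred_eq]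
  rw [Finset.filter_congr_decidable, this, Finset.filter_insert, Finset.filter_singleton]
  by_cases hu : u ∈ W <;> by_cases hw : w ∈ W <;> simp [hu, hw, huw, Xor]

/-- The hypotheses on `τ` cover X- and Z-type operators alike: symmetric differences become
products, so all images are commuting reflections. `expect_mul_of_commute` then charges `δ` for each
factor. -/
theorem expect_oddSet {F T : SiteSystem M} {Ω : F.Vec} (hΩ : expect Ω 1 = 1)
    (π : T.Op →⋆ₐ[ℂ] F.Op) {τ : Set ι → T.Op} (h0 : τ ∅ = 1)
    (hmul : ∀ Y Z, τ (symmDiff Y Z) = τ Y * τ Z) (hstar : ∀ Y, star (τ Y) = τ Y)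
    (s : J → Set ι) {δ : ℝ} (W : Finset J)
    (hW : ∀ j ∈ W, 1 - δ ≤ (expect Ω (π (τ (s j)))).re) :
    1 - W.card * δ ≤ (expect Ω (π (τ (oddSet s W)))).re := by
  classical
  induction W using Finset.induction_on with
  | empty => simp [oddSet_empty, h0, hΩ]
  | insert j W hj ih =>
    have hsq : ∀ Y, π (τ Y) * π (τ Y) = 1 := fun Y => by
      rw [← map_mul, ← hmul, symmDiff_self, Set.bot_eq_empty, h0, map_one]
    have hst : ∀ Y, star (π (τ Y)) = π (τ Y) := fun Y => by rw [← map_star, hstar]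
    have hcomm : π (τ (s j)) * π (τ (oddSet s W)) = π (τ (oddSet s W)) * π (τ (s j)) := by
      rw [← map_mul, ← map_mul, ← hmul, ← hmul, symmDiff_comm]
    have h1 := expect_mul_of_commute Ω (hst (s j)) (hst (oddSet s W)) (hsq _) (hsq _) hcomm
    have h2 := ih fun j hj => hW j (Finset.mem_insert_of_mem hj)
    have h3 := hW j (Finset.mem_insert_self j W)
    rw [oddSet_insert s hj, hmul, map_mul, Finset.card_insert_of_notMem hj]
    rw [hΩ, Complex.one_re] at h1
    push_cast
    linarith

end OddSet

/-! ### Two crossing loops on the patch -/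

section Loops

variable {N : ℕ}

/-- The vertices of the rectangle `[m + 1, 3 m] × [1, 4 m + 1]`. -/
def vertexBox (N m : ℕ) : Finset (Fin (N + 1) × Fin (N + 1)) :=
  {v | (m + 1 ≤ (v.1 : ℕ) ∧ (v.1 : ℕ) ≤ 3 * m) ∧ 1 ≤ (v.2 : ℕ) ∧ (v.2 : ℕ) ≤ 4 * m + 1}

/-- The plaquettes of the square `[0, 2 m] × [m + 1, 3 m + 1]`. -/
def plaquetteBox (N m : ℕ) : Finset (Fin N × Fin N) :=
  {p | (p.1 : ℕ) < 2 * m ∧ m + 1 ≤ (p.2 : ℕ) ∧ (p.2 : ℕ) ≤ 3 * m}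

theorem card_le_of_forall_mem {n a b a' b' : ℕ} (W : Finset (Fin n × Fin n))
    (hW : ∀ v ∈ W, (a ≤ (v.1 : ℕ) ∧ (v.1 : ℕ) < a + b) ∧ a' ≤ (v.2 : ℕ) ∧ (v.2 : ℕ) < a' + b') :
    W.card ≤ b * b' := by
  have h : (Finset.Ico a (a + b) ×ˢ Finset.Ico a' (a' + b')).card = b * b' := by simp
  rw [← h]
  refine Finset.card_le_card_of_injOn (fun v => ((v.1 : ℕ), (v.2 : ℕ))) ?_ ?_
  · intro v hv
    simpa using hW v hv
  · intro v _ w _ hvw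
    simpa [Prod.ext_iff, Fin.ext_iff] using hvw

theorem card_vertexBox {m : ℕ} (hm : 1 ≤ m) : (vertexBox N m).card ≤ 10 * m ^ 2 := by
  refine (card_le_of_forall_mem (a := m + 1) (b := 2 * m) (a' := 1) (b' := 4 * m + 1) _
    fun v hv => ?_).trans (by nlinarith)
  simp only [vertexBox, Finset.mem_filter, Finset.mem_univ, true_and] at hv
  omega

theorem card_plaquetteBox (m : ℕ) : (plaquetteBox N m).card ≤ 4 * m ^ 2 := by
  refine (card_le_of_forall_mem (a := 0) (b := 2 * m) (a' := m + 1) (b' := 2 * m) _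
    fun v hv => ?_).trans (by nlinarith)
  simp only [plaquetteBox, Finset.mem_filter, Finset.mem_univ, true_and] at hv
  omega

/-- The loop of links that leave `vertexBox`. -/
def xLoop (N m : ℕ) : Set (Link N) := oddSet vertexStar (vertexBox N m)

/-- The loop of links around `plaquetteBox`. -/
def zLoop (N m : ℕ) : Set (Link N) := oddSet plaquette (plaquetteBox N m)

/-- The upper half of `xLoop`. -/
def xArc (N m : ℕ) : Set (Link N) := {e ∈ xLoop N m | 2 * (m : ℝ) + 1 ≤ (Link.mid e).2}

theorem xLoop_eq_symmDiff (N m : ℕ) : xLoop N m = symmDiff (xLoop N m \ xArc N m) (xArc N m) := by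
  ext e
  simp only [Set.mem_symmDiff, Set.mem_sdiff, xArc, Set.mem_sep_iff]
  tauto

theorem inl_mem_xLoop {m : ℕ} {x : Fin N} {y : Fin (N + 1)} :
    (Sum.inl (x, y) : Link N) ∈ xLoop N m ↔
      ((x : ℕ) = m ∨ (x : ℕ) = 3 * m) ∧ m ≠ 3 * m ∧ 1 ≤ (y : ℕ) ∧ (y : ℕ) ≤ 4 * m + 1 := by
  rw [xLoop, mem_oddSet_iff_xor (u := (x.castSucc, y)) (w := (x.succ, y))]
  · simp only [vertexBox, Finset.mem_filter, Finset.mem_univ, true_and, Fin.val_castSucc,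
      Fin.val_succ, Xor]
    omega
  · simp [Fin.ext_iff]
  · intro v
    simp only [vertexStar, Set.mem_ofPred_eq, Link.Touches, Prod.ext_iff]
    tauto

theorem inr_mem_xLoop {m : ℕ} {x : Fin (N + 1)} {y : Fin N} :
    (Sum.inr (x, y) : Link N) ∈ xLoop N m ↔
      (m + 1 ≤ (x : ℕ) ∧ (x : ℕ) ≤ 3 * m) ∧ ((y : ℕ) = 0 ∨ (y : ℕ) = 4 * m + 1) := by
  rw [xLoop, mem_oddSet_iff_xor (u := (x, y.castSucc)) (w := (x, y.succ))]
  · simp only [vertexBox, Finset.mem_filter, Finset.mem_univ, true_and, Fin.val_castSucc,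
      Fin.val_succ, Xor]
    omega
  · simp [Fin.ext_iff]
  · intro v
    simp only [vertexStar, Set.mem_ofPred_eq, Link.Touches, Prod.ext_iff]
    tauto

theorem inl_mem_plaquette {x : Fin N} {y : Fin (N + 1)} {p : Fin N × Fin N} :
    (Sum.inl (x, y) : Link N) ∈ plaquette p ↔
      (p.1 : ℕ) = x ∧ ((p.2 : ℕ) = y ∨ (p.2 : ℕ) + 1 = y) := by
  simp [plaquette, Prod.ext_iff, Fin.ext_iff]
  omega

theorem inr_mem_plaquette {x : Fin (N + 1)} {y : Fin N} {p : Fin N × Fin N} :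
    (Sum.inr (x, y) : Link N) ∈ plaquette p ↔
      ((p.1 : ℕ) = x ∨ (p.1 : ℕ) + 1 = x) ∧ (p.2 : ℕ) = y := by
  simp [plaquette, Prod.ext_iff, Fin.ext_iff]
  omega

theorem inl_mem_zLoop {m : ℕ} (hN : 3 * m + 1 < N) {x : Fin N} {y : Fin (N + 1)} :
    (Sum.inl (x, y) : Link N) ∈ zLoop N m ↔
      (x : ℕ) < 2 * m ∧ ((y : ℕ) = m + 1 ∨ (y : ℕ) = 3 * m + 1) := by
  by_cases hy : 0 < (y : ℕ) ∧ (y : ℕ) < N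
  · rw [zLoop, mem_oddSet_iff_xor (u := (x, ⟨y - 1, by omega⟩)) (w := (x, ⟨y, hy.2⟩))]
    · simp only [plaquetteBox, Finset.mem_filter, Finset.mem_univ, true_and, Xor]
      omega
    · simp only [ne_eq, Prod.mk.injEq, Fin.mk.injEq]
      omega
    · intro p
      rw [inl_mem_plaquette]
      simp only [Prod.ext_iff, Fin.ext_iff]
      omega
  -- Links on the lower or upper edge of the patch border only one plaquette; the box does not reach
  -- these edges.
  · refine ⟨fun h => ?_, fun h => absurd h (by omega)⟩
    obtain ⟨p, hp, hp'⟩ := exists_mem_of_mem_oddSet h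
    rw [inl_mem_plaquette] at hp'
    simp only [plaquetteBox, Finset.mem_filter, Finset.mem_univ, true_and] at hp
    omega

theorem inr_mem_zLoop {m : ℕ} (hN : 3 * m + 1 < N) {x : Fin (N + 1)} {y : Fin N}
    (h : (Sum.inr (x, y) : Link N) ∈ zLoop N m) :
    ((x : ℕ) = 0 ∨ (x : ℕ) = 2 * m) ∧ (y : ℕ) ≤ 3 * m := by
  obtain ⟨p, hp, hp'⟩ := exists_mem_of_mem_oddSet h
  rw [inr_mem_plaquette] at hp'
  simp only [plaquetteBox, Finset.mem_filter, Finset.mem_univ, true_and] at hp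
  refine ⟨?_, by omega⟩
  by_contra hx
  have hx0 : 0 < (x : ℕ) ∧ (x : ℕ) < N := by omega
  rw [zLoop, mem_oddSet_iff_xor (u := (⟨x - 1, by omega⟩, y)) (w := (⟨x, hx0.2⟩, y))] at h
  · simp only [plaquetteBox, Finset.mem_filter, Finset.mem_univ, true_and, Xor] at h
    omega
  · simp only [ne_eq, Prod.mk.injEq, Fin.mk.injEq]
    omega
  · intro p
    rw [inr_mem_plaquette]
    simp only [Prod.ext_iff, Fin.ext_iff]
    omega

theorem inl_mem_xArc {m : ℕ} {x : Fin N} {y : Fin (N + 1)} :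
    (Sum.inl (x, y) : Link N) ∈ xArc N m ↔
      (Sum.inl (x, y) : Link N) ∈ xLoop N m ∧ 2 * m + 1 ≤ (y : ℕ) := by
  refine and_congr_right fun _ => ?_
  change 2 * (m : ℝ) + 1 ≤ ((y : ℕ) : ℝ) ↔ _
  norm_cast

theorem inr_mem_xArc {m : ℕ} {x : Fin (N + 1)} {y : Fin N} :
    (Sum.inr (x, y) : Link N) ∈ xArc N m ↔
      (Sum.inr (x, y) : Link N) ∈ xLoop N m ∧ 2 * m + 1 ≤ (y : ℕ) := by
  refine and_congr_right fun _ => ?_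
  rw [Link.mid]
  refine ⟨fun h => ?_, fun h => ?_⟩
  · have : (2 * m : ℝ) < (y : ℕ) := by linarith
    exact_mod_cast this
  · have : (2 * m + 1 : ℝ) ≤ (y : ℕ) := by exact_mod_cast h
    linarith

/-- The closed loops cross twice, on the left side of `xLoop` at heights `m + 1` and `3 * m + 1`.
The cut at height `2 * m + 1` separates the crossings, so the arc contains only the upper one. -/
theorem xArc_inter_zLoop {m : ℕ} (hm : 1 ≤ m) (hN : 3 * m + 1 < N) :
    xArc N m ∩ zLoop N m = {Sum.inl (⟨m, by omega⟩, ⟨3 * m + 1, by omega⟩)} := by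
  ext e
  rw [Set.mem_inter_iff, Set.mem_singleton_iff]
  rcases e with ⟨x, y⟩ | ⟨x, y⟩
  · rw [inl_mem_xArc, inl_mem_zLoop hN, inl_mem_xLoop]
    simp only [Sum.inl.injEq, Prod.mk.injEq, Fin.ext_iff]
    omega
  · simp only [reduceCtorEq, iff_false, not_and]
    intro h h'
    rw [inr_mem_xArc, inr_mem_xLoop] at h
    have := inr_mem_zLoop hN h'
    omega

theorem mid_of_mem_xArc {m : ℕ} {e : Link N} (he : e ∈ xArc N m) :
    ((Link.mid e).1 = m + 1 / 2 ∨ (Link.mid e).1 = 3 * m + 1 / 2) ∨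
      4 * (m : ℝ) + 1 ≤ (Link.mid e).2 := by
  rcases e with ⟨x, y⟩ | ⟨x, y⟩
  · rw [inl_mem_xArc, inl_mem_xLoop] at he
    refine Or.inl (he.1.1.imp (fun h => ?_) fun h => ?_) <;> simp [Link.mid, h]
  · rw [inr_mem_xArc, inr_mem_xLoop] at he
    have h : (y : ℕ) = 4 * m + 1 := by omega
    refine Or.inr ?_
    simp [Link.mid, h]

theorem mid_of_mem_xLoop_diff_xArc {m : ℕ} (hm : 1 ≤ m) {e : Link N}
    (he : e ∈ xLoop N m \ xArc N m) : (Link.mid e).2 ≤ 2 * m := by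
  obtain ⟨h1, h2⟩ := he
  rcases e with ⟨x, y⟩ | ⟨x, y⟩
  · rw [inl_mem_xArc, not_and, not_le] at h2
    have h : (y : ℕ) ≤ 2 * m := by have := h2 h1; omega
    simp only [Link.mid]
    exact_mod_cast h
  · rw [inr_mem_xArc, not_and, not_le] at h2
    have h3 := h2 h1
    rw [inr_mem_xLoop] at h1
    have h : (y : ℕ) = 0 := by omega
    have hm' : (1 : ℝ) ≤ m := by exact_mod_cast hm
    simp only [Link.mid, h]
    push_cast
    linarith

theorem mid_of_mem_zLoop {m : ℕ} (hN : 3 * m + 1 < N) {e : Link N} (he : e ∈ zLoop N m) :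
    ((Link.mid e).2 = m + 1 ∨ (Link.mid e).2 = 3 * m + 1) ∨
      ((Link.mid e).1 = 0 ∨ (Link.mid e).1 = 2 * m) := by
  rcases e with ⟨x, y⟩ | ⟨x, y⟩
  · rw [inl_mem_zLoop hN] at he
    refine Or.inl (he.2.imp (fun h => ?_) fun h => ?_) <;> simp [Link.mid, h]
  · refine Or.inr ((inr_mem_zLoop hN he).1.imp (fun h => ?_) fun h => ?_) <;> simp [Link.mid, h]

/-- The ends of `xArc` are far away from `zLoop`. -/
theorem not_close_of_mem {m : ℕ} (hm : 1 ≤ m) (hN : 3 * m + 1 < N) {e e₁ e₂ : Link N}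
    (he : e ∈ xArc N m) (he₁ : e₁ ∈ xLoop N m \ xArc N m) (he₂ : e₂ ∈ zLoop N m)
    (h₁ : dist (Link.mid e) (Link.mid e₁) < m / 2) (h₂ : dist (Link.mid e) (Link.mid e₂) < m / 2) :
    False := by
  have hm' : (1 : ℝ) ≤ m := by exact_mod_cast hm
  have hy := he.2
  have ha := mid_of_mem_xArc he
  have hb := mid_of_mem_xLoop_diff_xArc hm he₁
  have hc := mid_of_mem_zLoop hN he₂
  rw [Prod.dist_eq, max_lt_iff, Real.dist_eq, Real.dist_eq, abs_lt, abs_lt] at h₁ h₂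
  obtain ⟨-, -, h₁⟩ := h₁
  obtain ⟨⟨h3, h4⟩, h5, h6⟩ := h₂
  -- Being near the lower half keeps `e` on a vertical side at height below `5 * m / 2`. The
  -- tightest comparison is between the left side at `m + 1 / 2` and the line at `2 * m`: the gap `m
  -- - 1 / 2` is at least `m / 2` because `m ≥ 1`.
  rcases ha with (ha | ha) | ha
  · rcases hc with (hc | hc) | (hc | hc) <;> linarith
  · rcases hc with (hc | hc) | (hc | hc) <;> linarith
  · linarith

end Loops

/-! ### Loops against light cones, and the choice of constants -/

section Main

theorem le_re_expect_of_projExpectation {F T : SiteSystem M} {ρ : T.Op} {Ω : F.Vec}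
    {π : T.Op →⋆ₐ[ℂ] F.Op} (hΩ : expect Ω 1 = 1) (hπ : ∀ O, expect Ω (π O) = (ρ * O).trace)
    {O : T.Op} {ε : ℝ} (h : projExpectation ρ O > 1 - ε) : 1 - 2 * ε ≤ (expect Ω (π O)).re := by
  have e : (ρ * ((1 / 2 : ℂ) • (1 + O))).trace = ((1 / 2 : ℝ) : ℂ) * (1 + expect Ω (π O)) := by
    rw [← hπ, map_smul, map_add, map_one, expect_smul, expect_add, hΩ]
    norm_num
  rw [projExpectation, e, Complex.re_ofReal_mul, Complex.add_re, Complex.one_re] at h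
  linarith

variable [PseudoMetricSpace M]

/-- Allows symmetric differences and intersections of link sets to be carried over to sets of sites.
-/
theorem LatticePatch.site_injective {T : SiteSystem M} {N : ℕ} {a : ℝ} (ha : 0 < a)
    (L : LatticePatch T N a) : Function.Injective L.site := by
  intro e e' h
  have h1 := L.spacing e e'
  rw [h, dist_self] at h1
  have h2 : Link.mid e = Link.mid e' :=
    dist_le_zero.1 (nonpos_of_mul_nonpos_right h1 ha)
  have hint : ∀ n k : ℕ, (n : ℝ) + 1 / 2 ≠ k := fun n k h => by
    have : ((2 * n + 1 : ℕ) : ℝ) = ((2 * k : ℕ) : ℝ) := by push_cast; linarith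
    have := Nat.cast_injective this
    omega
  rcases e with ⟨x, y⟩ | ⟨x, y⟩ <;> rcases e' with ⟨x', y'⟩ | ⟨x', y'⟩ <;>
    simp only [Link.mid, Prod.ext_iff] at h2
  · simpa [Prod.ext_iff, Fin.ext_iff] using h2
  · exact (hint _ _ h2.1).elim
  · exact (hint _ _ h2.1.symm).elim
  · simpa [Prod.ext_iff, Fin.ext_iff] using h2

/-- A state with small dependency cones does not satisfy the stabilizer conditions on a large box. -/
theorem HasConeModel.false_of_stabilizers {T : SiteSystem M} {ρ : T.Op} {R a ε : ℝ} {N m : ℕ}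
    (h : HasConeModel (fun i => Metric.closedBall (T.pos i) R) ρ) (L : LatticePatch T N a)
    (ha : 0 < a) (hm : 1 ≤ m) (hN : 4 * m + 2 ≤ N) (hε0 : 0 < ε)
    (hε : 400 * (m ^ 2 * ε) ≤ 1)
    (hR : R < a * m / 4)
    (hv : ∀ v, IsInner v → projExpectation ρ (vertexOp L v) > 1 - ε)
    (hp : ∀ p, projExpectation ρ (plaquetteOp L p) > 1 - ε) : False := by
  obtain ⟨F, Ω, π, hΩ, hπ, hE⟩ := h
  have hΩ1 : expect Ω 1 = 1 := by
    obtain ⟨φ, hφ, rfl⟩ := hΩ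
    rw [expect, Matrix.one_mulVec, star_productVec_dotProduct_self hφ]
  have hinj := L.site_injective ha
  have hdim : ∀ Y : Set (Link N), ∀ i ∈ L.site '' Y, T.dim i = 2 := by
    rintro Y _ ⟨e, -, rfl⟩
    exact L.isQubit e
  have hX : ∀ Y Z : Set (Link N), pauliX (L.site '' symmDiff Y Z) =
      pauliX (L.site '' Y) * pauliX (L.site '' Z) := fun Y Z => by
    rw [Set.image_symmDiff hinj, pauliX_symmDiff (hdim Y) (hdim Z)]
  have hZ : ∀ Y Z : Set (Link N), pauliZ (L.site '' symmDiff Y Z) =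
      pauliZ (L.site '' Y) * pauliZ (L.site '' Z) := fun Y Z => by
    rw [Set.image_symmDiff hinj, pauliZ_symmDiff]
  have hX1 : ∀ Y : Set (Link N), star (π (pauliX (L.site '' Y))) * π (pauliX (L.site '' Y)) = 1 :=
    fun Y => by
      rw [← map_star, star_pauliX, ← map_mul, ← hX, symmDiff_self, Set.bot_eq_empty,
        Set.image_empty, pauliX_empty, map_one]
  have hxE := expect_oddSet hΩ1 π (τ := fun Y : Set (Link N) => pauliX (L.site '' Y))
    (by simp only [Set.image_empty, pauliX_empty]) hX (fun _ => star_pauliX) vertexStar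
    (δ := 2 * ε) (vertexBox N m) fun v hv' => by
      refine le_re_expect_of_projExpectation hΩ1 hE (hv v ?_)
      simp only [vertexBox, Finset.mem_filter, Finset.mem_univ, true_and] at hv'
      simp only [IsInner]
      omega
  have hzE := expect_oddSet hΩ1 π (τ := fun Y : Set (Link N) => pauliZ (L.site '' Y))
    (by simp only [Set.image_empty, pauliZ_empty]) hZ (fun _ => star_pauliZ) plaquette
    (δ := 2 * ε) (plaquetteBox N m) fun p _ => le_re_expect_of_projExpectation hΩ1 hE (hp p)
  have hcx : ((vertexBox N m).card : ℝ) ≤ 10 * m ^ 2 := by exact_mod_cast card_vertexBox hm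
  have hcz : ((plaquetteBox N m).card : ℝ) ≤ 4 * m ^ 2 := by exact_mod_cast card_plaquetteBox m
  have hbx := mul_le_mul_of_nonneg_right hcx hε0.le
  have hbz := mul_le_mul_of_nonneg_right hcz hε0.le
  have hN' : 3 * m + 1 < N := by omega
  refine hΩ.false_of_anticommute (P := π (pauliX (L.site '' xArc N m)))
    (R := π (pauliX (L.site '' (xLoop N m \ xArc N m)))) (L := π (pauliZ (L.site '' zLoop N m)))
    (hπ _ _ supportedOn_pauliX) (hπ _ _ supportedOn_pauliX) (hπ _ _ supportedOn_pauliZ)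
    ?_ (hX1 _) (hX1 _) ?_ ?_ ?_ ?_ ?_
  · rintro i ⟨_, ⟨e, he, rfl⟩, hi⟩ ⟨_, ⟨e₁, he₁, rfl⟩, hi₁⟩ ⟨_, ⟨e₂, he₂, rfl⟩, hi₂⟩
    -- Two cones of radius `R` that share a point have centres at distance at most `2 * R < a * m /
    -- 2`.
    have hclose : ∀ e', F.pos i ∈ Metric.closedBall (T.pos (L.site e')) R →
        dist (Link.mid e) (Link.mid e') < m / 2 := fun e' hi' => by
      have h1 := dist_triangle_left (T.pos (L.site e)) (T.pos (L.site e')) (F.pos i)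
      have h2 := L.spacing e e'
      rw [Metric.mem_closedBall] at hi hi'
      have h3 : a * dist (Link.mid e) (Link.mid e') < a * (m / 2) := by linarith
      exact lt_of_mul_lt_mul_left h3 ha.le
    exact not_close_of_mem hm hN' he he₁ he₂ (hclose e₁ hi₁) (hclose e₂ hi₂)
  · rw [← map_star, star_pauliZ]
  · rw [← map_mul, ← hZ, symmDiff_self, Set.bot_eq_empty, Set.image_empty, pauliZ_empty, map_one]
  · rw [← map_mul, ← map_mul, ← map_neg, pauliX_mul_pauliZ (hdim _)]
    rw [← Set.image_inter hinj, xArc_inter_zLoop hm hN', Set.image_singleton]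
  -- At most `10 * m ^ 2` vertices with defect `2 * ε` each cost `20 * m ^ 2 * ε ≤ 1 / 20`, within
  -- the permitted `1 / 8`.
  · rw [← map_mul, ← hX, ← xLoop_eq_symmDiff]
    refine le_trans ?_ hxE
    linarith
  · refine le_trans ?_ hzE
    linarith

end Main

end LEDWitness

end

theorem theorem2 :
    ∃ c > (0 : ℝ), ∃ ε₀ > (0 : ℝ), ∃ N₀ : ℕ,
      ∀ (M : Type*) [PseudoMetricSpace M] (S : LEDWitness.SiteSystem M) (ρ : S.Op),
        LEDWitness.IsDensity ρ →
      ∀ (κ d : ℝ) (P : LEDWitness.LED S κ d)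
        (a : ℝ) (N : ℕ) (L : LEDWitness.LatticePatch (S.append P.anc) N a) (ε : ℝ),
        0 < a → N₀ ≤ N → 0 < ε → ε ≤ ε₀ →
        (∀ v, LEDWitness.IsInner v →
          LEDWitness.projExpectation (P.output ρ) (LEDWitness.vertexOp L v) > 1 - ε) →
        (∀ p, LEDWitness.projExpectation (P.output ρ) (LEDWitness.plaquetteOp L p) > 1 - ε) →
      ∀ (r : ℝ) (D : ℕ), 0 < r →
        (D : ℝ) < (c * (a * min (N : ℝ) (1 / √ε)) - κ * d) / r →
        ¬ LEDWitness.HasPurificationOfDepth ρ r D := by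
  -- The values `20` and `1 / 400` make `l ≥ 20`, so that `m = ⌊l / 20⌋₊` is at least 1. Then `l /
  -- 20 < m + 1 ≤ 2 * m`, and `a * m / 4` is at least `a * l / 160`.
  refine ⟨1 / 160, by norm_num, 1 / 400, by norm_num, 20, ?_⟩
  intro M _ S ρ _ κ d P a N L ε ha hN hε hε₀ hv hp r D hr hD hρ
  set l : ℝ := min (N : ℝ) (1 / √ε)
  have hs : 0 < √ε := Real.sqrt_pos.2 hε
  have hs20 : √ε ≤ 1 / 20 := by
    rw [Real.sqrt_le_left (by norm_num)]
    linarith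
  have hl20 : 20 ≤ l := by
    refine le_min (by exact_mod_cast hN) ?_
    rw [le_div_iff₀ hs]
    linarith
  set m : ℕ := ⌊l / 20⌋₊
  have hml : (m : ℝ) ≤ l / 20 := Nat.floor_le (by linarith)
  have hm : 1 ≤ m := Nat.le_floor (by rw [Nat.cast_one]; linarith)
  have hm' : (1 : ℝ) ≤ m := by exact_mod_cast hm
  have hlm : l / 20 < m + 1 := Nat.lt_floor_add_one _
  have hmN : 20 * m ≤ N := by
    have h1 : (m : ℝ) ≤ N / 20 := hml.trans (by linarith [min_le_left (N : ℝ) (1 / √ε)])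
    have h2 : (20 : ℝ) * m ≤ N := by linarith
    exact_mod_cast h2
  -- Here the bound `l ≤ 1 / √ε` enters: it keeps the accumulated stabilizer defect bounded.
  have hmε : 400 * ((m : ℝ) ^ 2 * ε) ≤ 1 := by
    have h1 : (m : ℝ) * √ε ≤ 1 / 20 := by
      calc (m : ℝ) * √ε ≤ 1 / √ε / 20 * √ε :=
            mul_le_mul_of_nonneg_right
              (hml.trans (by linarith [min_le_right (N : ℝ) (1 / √ε)])) hs.le
        _ = 1 / 20 := by field_simp
    have h2 : ((m : ℝ) * √ε) ^ 2 = (m : ℝ) ^ 2 * ε := by rw [mul_pow, Real.sq_sqrt hε.le]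
    have h3 : 0 ≤ (m : ℝ) * √ε := by positivity
    rw [← h2]
    nlinarith
  have hR : D * r + P.range < a * m / 4 := by
    rw [lt_div_iff₀ hr] at hD
    have h1 : a * l ≤ a * (40 * m) := mul_le_mul_of_nonneg_left (by linarith) ha.le
    linarith [P.range_le]
  have : Nonempty M := ⟨(S.append P.anc).pos (L.site (Sum.inl (⟨0, by omega⟩, 0)))⟩
  exact (hρ.hasConeModel hr.le P).false_of_stabilizers L ha hm (by omega) hε hmε hR hv hp
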